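/- Let $z\in\mathbb R^n$ be a signal with $\|z\|=1$, let $a_1,\dots,a_m\in\mathbb C^n$ be Gaussian random measurements, i.e. i.i.d. random vectors with law $\mathcal N(0,I/2)+i\,\mathcal N(0,I/2)$, and let $y_j=|\langle a_j,z\rangle|^2$ be the observations. Write $a_j=a_{jR}+i\,a_{jI}$ with $a_{jR},a_{jI}\in\mathbb R^n$, and $\mathrm{dist}(x,z)=\min\{\|z-x\|,\|z+x\|\}$ for $x\in\mathbb R^n$. All norms are Euclidean. For $\epsilon\in(0,1/2)$ put $L(\epsilon)=\log_2\log_2(1/\epsilon)>0$. The re-sampled Gauss–Newton method with parameters $c>0$ and $\epsilon$ is the following procedure. 1. Set $T=\lceil c\,L(\epsilon)\rceil$ and $m'=\lfloor m/(T+1)\rfloor$. 2. Choose, independently of the data, $T+1$ disjoint blocks, each of $m'$ of the pairs $(a_j,y_j)$; denote them by $(a^{(k)}_j,y^{(k)}_j)_{1\le j\le m'}$, $k=0,\dots,T$. 3. With $\lambda=\big(\frac1{m'}\sum_j y^{(0)}_j\big)^{1/2}$, let $x_0\in\mathbb R^n$ be an eigenvector with $\|x_0\|=\lambda$ for the largest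 eigenvalue of the (entrywise) real part of $\frac1{m'}\sum_{j}\big(\frac12-\exp(-y^{(0)}_j/\lambda^2)\big)a^{(0)}_j a^{(0)*}_j$. 4. For $k=0,\dots,T-1$ set $x_{k+1}=x_k-\big(J^{k+1}(x_k)^{\top}J^{k+1}(x_k)\big)^{-1}J^{k+1}(x_k)^{\top}F^{k+1}(x_k)$. Here $F^{k}(x)\in\mathbb R^{m'}$ has entries $F^k_j(x)=\frac1{\sqrt{m'}}\big(\langle a^{(k)}_{jR},x\rangle^2+\langle a^{(k)}_{jI},x\rangle^2-y^{(k)}_j\big)$, and $J^k(x)\in\mathbb R^{m'\times n}$ is its Jacobian, with $j$-th row $\frac{2}{\sqrt{m'}}\big(\langle a^{(k)}_{jR},x\rangle a^{(k)}_{jR}+\langle a^{(k)}_{jI},x\rangle a^{(k)}_{jI}\big)^{\top}$. The output is $x_T$. **Statement.** There are absolute constants $c_0>0$ and $\tilde c>0$ such that for every $c\ge c_0$ and every $\epsilon\in(0,1/2)$ there is a constant $C>0$, depending only on $c$ and $\epsilon$, with the following property. For all $n$ and $m$, every $z\in\mathbb R^n$ with $\|z\|=1$ and every choice of the blocks in step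 2, if $$m\ \ge\ C\cdot L(\epsilon)\cdot n\log n ,$$ then with probability at least $1-\tilde c/n^2$ an initial guess $x_0$ exists and, for every choice of $x_0$ allowed in step 3, all the matrices inverted in step 4 are nonsingular and the output after $T=\lceil c\,L(\epsilon)\rceil$ iterations satisfies $$\mathrm{dist}(x_T,z)<\epsilon .$$ -/

import Mathlib

open MeasureTheory ProbabilityTheory

namespace GaussNewtonPR

/-- Real signals, with the Euclidean norm. -/
abbrev RVec (n : ℕ) := EuclideanSpace ℝ (Fin n)

/-- Complex measurement vectors, with the Hermitian inner product. -/
abbrev CVec (n : ℕ) := EuclideanSpace ℂ (Fin n)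

/-- The entrywise real part `a_R` of `a = a_R + i a_I`. -/
noncomputable def rePart {n : ℕ} (a : CVec n) : RVec n := WithLp.toLp 2 fun i => (a i).re

/-- The entrywise imaginary part `a_I` of `a = a_R + i a_I`. -/
noncomputable def imPart {n : ℕ} (a : CVec n) : RVec n := WithLp.toLp 2 fun i => (a i).im

/-- A real vector seen as a complex vector. -/
noncomputable def toComplex {n : ℕ} (x : RVec n) : CVec n := WithLp.toLp 2 fun i => (x i : ℂ)

/-- The law `N(0, I/2) + i N(0, I/2)` on `ℂⁿ`: the real and imaginary parts of the entries are
independent real Gaussians with mean `0` and variance `1/2`. -/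
noncomputable def complexGaussian (n : ℕ) : Measure (CVec n) :=
  ((Measure.pi fun _ : Fin n => gaussianReal 0 (1 / 2)).prod
    (Measure.pi fun _ : Fin n => gaussianReal 0 (1 / 2))).map
      fun p => (WithLp.toLp 2 fun i => (p.1 i : ℂ) + (p.2 i : ℂ) * Complex.I : CVec n)

/-- The vectors `a_1, …, a_m` are (complex) Gaussian random measurements: i.i.d. random vectors
with law `N(0, I/2) + i N(0, I/2)`. -/
def IsGaussianMeasurements {Ω : Type*} [MeasurableSpace Ω] (μ : Measure Ω) {m n : ℕ}
    (a : Fin m → Ω → CVec n) : Prop :=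
  iIndepFun a μ ∧ ∀ j, HasLaw (a j) (complexGaussian n) μ

/-- The phaseless observation `|⟨a, z⟩|²` of the real signal `z`. -/
noncomputable def observation {n : ℕ} (z : RVec n) (a : CVec n) : ℝ :=
  ‖inner ℂ a (toComplex z)‖ ^ 2

/-- The distance of real vectors up to a global sign. -/
noncomputable def signDist {n : ℕ} (x z : RVec n) : ℝ := min ‖z - x‖ ‖z + x‖

/-- `λ`, the square root of the average of the observations. -/
noncomputable def meanScale {m : ℕ} (y : Fin m → ℝ) : ℝ := √((1 / m : ℝ) * ∑ j, y j)

/-- The Hermitian matrix `(1/m) ∑ (1/2 - exp (-y_j / λ²)) a_j a_j^*`. -/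
noncomputable def initMatrix {m n : ℕ} (a : Fin m → CVec n) (y : Fin m → ℝ) :
    Matrix (Fin n) (Fin n) ℂ :=
  (1 / m : ℂ) • ∑ j, ((1 / 2 - Real.exp (-(y j) / meanScale y ^ 2) : ℝ) : ℂ) •
    Matrix.vecMulVec (fun i => a j i) (fun i => star (a j i))

/-- The entrywise real part of `initMatrix`, a real symmetric matrix, as a linear map. -/
noncomputable def initMap {m n : ℕ} (a : Fin m → CVec n) (y : Fin m → ℝ) :
    Module.End ℝ (RVec n) :=
  Matrix.toEuclideanLin ((initMatrix a y).map Complex.re)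

/-- `x` is an eigenvector for the largest eigenvalue of the real part of `initMatrix`, with norm
`λ`. It is determined at best up to sign, so this is a relation. -/
def IsInitialGuess {m n : ℕ} (a : Fin m → CVec n) (y : Fin m → ℝ) (x : RVec n) : Prop :=
  ‖x‖ = meanScale y ∧
    ∃ t : ℝ, IsGreatest {s : ℝ | (initMap a y).HasEigenvalue s} t ∧ (initMap a y).HasEigenvector t x

/-- The residual vector `F(x)`,
`F_j(x) = (1/√m) (⟨a_{jR}, x⟩² + ⟨a_{jI}, x⟩² - y_j)`. -/
noncomputable def residual {m n : ℕ} (a : Fin m → CVec n) (y : Fin m → ℝ) (x : RVec n) :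
    Fin m → ℝ :=
  fun j => 1 / √(m : ℝ) *
    (inner ℝ (rePart (a j)) x ^ 2 + inner ℝ (imPart (a j)) x ^ 2 - y j)

/-- The Jacobian `J(x)`, whose `j`-th row is
`(2/√m) (a_{jR} a_{jR}ᵀ x + a_{jI} a_{jI}ᵀ x)ᵀ`. -/
noncomputable def jacobian {m n : ℕ} (a : Fin m → CVec n) (x : RVec n) :
    Matrix (Fin m) (Fin n) ℝ :=
  Matrix.of fun j i => 2 / √(m : ℝ) *
    (inner ℝ (rePart (a j)) x * rePart (a j) i + inner ℝ (imPart (a j)) x * imPart (a j) i)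

/-- The matrix `J(x)ᵀ J(x)`. -/
noncomputable def gram {m n : ℕ} (a : Fin m → CVec n) (x : RVec n) : Matrix (Fin n) (Fin n) ℝ :=
  (jacobian a x).transpose * jacobian a x

/-- The Gauss–Newton step `x - (J(x)ᵀ J(x))⁻¹ J(x)ᵀ F(x)`; it is meaningful when `gram a x` is
nonsingular. -/
noncomputable def gaussNewtonStep {m n : ℕ} (a : Fin m → CVec n) (y : Fin m → ℝ) (x : RVec n) :
    RVec n :=
  x - WithLp.toLp 2 ((gram a x)⁻¹.mulVec ((jacobian a x).transpose.mulVec (residual a y x)))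

/-- A choice of `T + 1` disjoint blocks of `⌊m / (T + 1)⌋` of the indices `1, …, m`
(a partition into equal blocks when `T + 1` divides `m`). -/
abbrev Blocks (m T : ℕ) := Fin (T + 1) × Fin (m / (T + 1)) ↪ Fin m

/-- The `k`-th block of a family indexed by `Fin m`. -/
def block {m T : ℕ} {α : Type*} (σ : Blocks m T) (f : Fin m → α) (k : Fin (T + 1)) :
    Fin (m / (T + 1)) → α :=
  fun i => f (σ (k, i))

/-- The `k`-th normal matrix `J^{k+1}(x_k)ᵀ J^{k+1}(x_k)`, `k = 0, …, T - 1`, formed with the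
`(k+1)`-st block, along a sequence `x_0, …, x_T`. -/
noncomputable def stepGram {m n T : ℕ} (σ : Blocks m T) (a : Fin m → CVec n)
    (x : Fin (T + 1) → RVec n) (k : Fin T) : Matrix (Fin n) (Fin n) ℝ :=
  gram (block σ a k.succ) (x k.castSucc)

/-- `x_0, …, x_T` is produced by the re-sampled Gauss–Newton method from the data `(a, y)` split
into blocks by `σ`: `x_0` is an initial guess computed from block `0`, and `x_{k+1}` is the
Gauss–Newton step from `x_k` with block `k + 1`, for `k = 0, …, T - 1`. -/
def IsRun {m n T : ℕ} (σ : Blocks m T) (a : Fin m → CVec n) (y : Fin m → ℝ)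
    (x : Fin (T + 1) → RVec n) : Prop :=
  IsInitialGuess (block σ a 0) (block σ y 0) (x 0) ∧
    ∀ k : Fin T, x k.succ =
      gaussNewtonStep (block σ a k.succ) (block σ y k.succ) (x k.castSucc)

/-- `log log (1/ε)` with logarithms to base `2`; it is positive exactly when `ε < 1/2`
(for `0 < ε < 1`). -/
noncomputable def loglog (ε : ℝ) : ℝ := Real.logb 2 (Real.logb 2 (1 / ε))

/-- The number of iterations, `T = c log log (1/ε)` rounded up. -/
noncomputable def iterationCount (c ε : ℝ) : ℕ := ⌈c * loglog ε⌉₊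

end GaussNewtonPR

namespace GaussNewtonPR

/-! Fix the number `T` of iterations. The constant `C` may depend on `c` and `ε`, hence on `T`, so
every block may be assumed to have at least a large multiple of `n log n` measurements. It remains
to control one spectral initialization and `T` Gauss–Newton steps, each with failure probability at
most `1 / ((T + 1) n²)`.

Initialization. For a unit vector `z` the variable `energy a z` is exponential with mean `1`, and
the weight `1/2 - exp(-energy a z)` has mean zero, so the directions orthogonal to `z` cancel: the
mean of the weighted quadratic form at `v` is `⟨v, z⟩² / 4` (`hasMean_weighted_energy`). A Chernoff
bound with a union bound over a grid of polynomially fine mesh, whose logarithmic size is of order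
`n log n`, gives this up to a small `η` uniformly on the sphere (`exists_uniform_sum_le`,
`exists_initRegular`). A top eigenvector is then close to `z` or `-z`
(`InitRegular.norm_sub_sq_le`).

One step. The residual is exactly quadratic: `F(x) = J(x)(x - z) - q`, with `q` made of the energies
of `x - z`. The new error `w` solves `JᵀJ w = Jᵀq`, so `J w` is the orthogonal projection of `q` and
`‖J w‖ ≤ ‖q‖` (`norm_gaussNewtonStep_sub_sq_le`). A uniform lower bound on `J`
(`exists_sample_size_corr`) and a bound on `‖q‖` by a multiple of `‖x - z‖²`
(`exists_sample_size_energy_sq`) yield error at most `315 ‖x - z‖²`. Both bounds are needed only for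
fixed `x`. This matters for `q`, whose squared entries have tails too heavy for a uniform Chernoff
bound.

Iteration. Each step uses a fresh block, independent of the current iterate, so Fubini turns the
bound at fixed `x` into one along the trajectory (`exists_trajectory_good`). This requires a
measurable `x_0`. For a regular block the normalized eigenvector on the side of `z` is unique, hence
a Borel function of the block (`exists_measurable_guess`); the opposite sign follows since the step
is odd. The scaled error `315 ‖x_k - z‖` starts below `1/4` and is squared at each step, so `2 ^ T ≥
log₂(1/ε)` suffices. -/

/-- The law `N(0, 1/2)` of the real and imaginary parts of the entries of a measurement. -/
noncomputable abbrev halfGaussian : Measure ℝ := gaussianReal 0 (1 / 2)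

/-- The law of a vector of `n` independent `N(0, 1/2)` variables. -/
noncomputable abbrev halfGaussianPi (n : ℕ) : Measure (Fin n → ℝ) :=
  Measure.pi fun _ => halfGaussian

/-! ### Joint laws of linear functionals of Gaussian vectors -/

theorem memLp_eval_halfGaussianPi {n : ℕ} (i : Fin n) :
    MemLp (fun p : Fin n → ℝ => p i) 2 (halfGaussianPi n) :=
  (memLp_id_gaussianReal' 2 (by simp)).comp_measurePreserving
    (measurePreserving_eval (fun _ : Fin n => halfGaussian) i)

theorem covariance_eval_halfGaussianPi {n : ℕ} (i j : Fin n) :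
    cov[fun p => p i, fun p => p j; halfGaussianPi n] = if i = j then 1 / 2 else 0 := by
  split_ifs with h
  · subst h
    have := variance_id_map (X := fun p : Fin n → ℝ => p i) (μ := halfGaussianPi n)
      (Measurable.aemeasurable (by fun_prop))
    rw [covariance_self (Measurable.aemeasurable (by fun_prop)), ← this]
    have h2 := (measurePreserving_eval (fun _ : Fin n => halfGaussian) i).map_eq
    have h3 : Measure.map (fun p : Fin n → ℝ => p i) (halfGaussianPi n) = halfGaussian := h2
    rw [h3, variance_id_gaussianReal]
    norm_num
  · have hi := (iIndepFun_pi (μ := fun _ : Fin n => halfGaussian)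
      (X := fun _ x => x) (fun _ => aemeasurable_id)).indepFun h
    exact hi.covariance_eq_zero (memLp_eval_halfGaussianPi i) (memLp_eval_halfGaussianPi j)

theorem hasGaussianLaw_halfGaussianPi (n : ℕ) :
    HasGaussianLaw (fun p : Fin n → ℝ => p) (halfGaussianPi n) := by
  refine iIndepFun.hasGaussianLaw (X := fun i (p : Fin n → ℝ) => p i) (fun i => ?_)
    (iIndepFun_pi (μ := fun _ : Fin n => halfGaussian) (X := fun _ x => x)
      (fun _ => aemeasurable_id))
  constructor
  have h2 := (measurePreserving_eval (fun _ : Fin n => halfGaussian) i).map_eq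
  have h3 : Measure.map (fun p : Fin n → ℝ => p i) (halfGaussianPi n) = halfGaussian := h2
  rw [h3]
  infer_instance

theorem covariance_linear_halfGaussianPi {n : ℕ} (x r : RVec n) :
    cov[fun p => ∑ i, x i * p i, fun p => ∑ i, r i * p i; halfGaussianPi n] =
      inner ℝ x r / 2 := by
  rw [covariance_fun_sum_fun_sum (fun i => (memLp_eval_halfGaussianPi i).const_mul _)
    (fun i => (memLp_eval_halfGaussianPi i).const_mul _)]
  simp only [covariance_const_mul_left, covariance_const_mul_right,
    covariance_eval_halfGaussianPi, mul_ite, mul_zero, Finset.sum_ite_eq, Finset.mem_univ, if_true,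
    PiLp.inner_apply, RCLike.inner_apply, conj_trivial, Finset.sum_div]
  exact Finset.sum_congr rfl fun i _ => by ring

theorem map_linear_halfGaussianPi {n : ℕ} (x : RVec n) :
    (halfGaussianPi n).map (fun p => ∑ i, x i * p i) = halfGaussian.map (fun q => ‖x‖ * q) := by
  have hg : HasGaussianLaw (fun p : Fin n → ℝ => ∑ i, x i * p i) (halfGaussianPi n) :=
    (hasGaussianLaw_halfGaussianPi n).map_fun
      (∑ i, x i • ContinuousLinearMap.proj (R := ℝ) (φ := fun _ : Fin n => ℝ) i) |>.congr
        (Filter.Eventually.of_forall fun p => by simp)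
  rw [hg.map_eq_gaussianReal, gaussianReal_map_const_mul]
  have hE : ∫ p, ∑ i, x i * p i ∂(halfGaussianPi n) = 0 := by
    rw [integral_finsetSum _ fun i _ =>
      ((memLp_eval_halfGaussianPi i).integrable (by norm_num)).const_mul _]
    refine Finset.sum_eq_zero fun i _ => ?_
    rw [integral_const_mul]
    have h2 := (measurePreserving_eval (fun _ : Fin n => halfGaussian) i).map_eq
    have h3 : ∫ p, p i ∂(halfGaussianPi n) = ∫ t, t ∂halfGaussian := by
      rw [← h2, integral_map (Measurable.aemeasurable (by fun_prop)) (by fun_prop)]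
    rw [h3, integral_id_gaussianReal, mul_zero]
  congr 1
  · simp only [mul_zero]; exact hE
  · rw [← covariance_self (Measurable.aemeasurable (by fun_prop)), covariance_linear_halfGaussianPi,
      real_inner_self_eq_norm_sq]
    ext
    simp only [NNReal.coe_mul, NNReal.coe_mk]
    rw [Real.coe_toNNReal _ (by positivity)]
    push_cast
    ring

/-- Orthogonal functionals are uncorrelated, and uncorrelated jointly Gaussian variables are
independent. -/
theorem map_pair_halfGaussianPi {n : ℕ} (x r : RVec n) (h : inner ℝ x r = 0) :
    (halfGaussianPi n).map (fun p => (∑ i, x i * p i, ∑ i, r i * p i)) =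
      (halfGaussian.prod halfGaussian).map (fun q => (‖x‖ * q.1, ‖r‖ * q.2)) := by
  have hg : HasGaussianLaw (fun p : Fin n → ℝ => (∑ i, x i * p i, ∑ i, r i * p i))
      (halfGaussianPi n) :=
    (hasGaussianLaw_halfGaussianPi n).map_fun
      ((∑ i, x i • ContinuousLinearMap.proj (R := ℝ) (φ := fun _ : Fin n => ℝ) i).prod
        (∑ i, r i • ContinuousLinearMap.proj (R := ℝ) (φ := fun _ : Fin n => ℝ) i)) |>.congr
        (Filter.Eventually.of_forall fun p => by simp)
  have hi := hg.indepFun_of_covariance_eq_zero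
    (by rw [covariance_linear_halfGaussianPi, h, zero_div])
  rw [(indepFun_iff_map_prod_eq_prod_map_map (Measurable.aemeasurable (by fun_prop))
    (Measurable.aemeasurable (by fun_prop))).1 hi,
    map_linear_halfGaussianPi, map_linear_halfGaussianPi,
    Measure.map_prod_map _ _ (by fun_prop) (by fun_prop)]
  rfl

/-- Four independent `N(0, 1/2)` variables. -/
noncomputable abbrev fourGaussian : Measure ((ℝ × ℝ) × (ℝ × ℝ)) :=
  (halfGaussian.prod halfGaussian).prod (halfGaussian.prod halfGaussian)

instance isProbabilityMeasure_complexGaussian (n : ℕ) :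
    IsProbabilityMeasure (complexGaussian n) :=
  Measure.isProbabilityMeasure_map (by fun_prop)

@[fun_prop]
theorem measurable_rePart {n : ℕ} : Measurable (rePart : CVec n → RVec n) := by
  unfold rePart; fun_prop

@[fun_prop]
theorem measurable_imPart {n : ℕ} : Measurable (imPart : CVec n → RVec n) := by
  unfold imPart; fun_prop

/-- Every expectation needed later involves one measurement and two orthogonal directions, so it
becomes an integral in four independent scalar Gaussians. -/
theorem map_coords_complexGaussian {n : ℕ} (x r : RVec n) (h : inner ℝ x r = 0) :
    (complexGaussian n).map (fun a => ((inner ℝ (rePart a) x, inner ℝ (rePart a) r),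
      (inner ℝ (imPart a) x, inner ℝ (imPart a) r))) =
    fourGaussian.map (fun q => ((‖x‖ * q.1.1, ‖r‖ * q.1.2), (‖x‖ * q.2.1, ‖r‖ * q.2.2))) := by
  have h1 := map_pair_halfGaussianPi x r h
  rw [complexGaussian, Measure.map_map (by fun_prop) (by fun_prop)]
  have h2 : ((fun a : CVec n => ((inner ℝ (rePart a) x, inner ℝ (rePart a) r),
      (inner ℝ (imPart a) x, inner ℝ (imPart a) r))) ∘
      fun p : (Fin n → ℝ) × (Fin n → ℝ) =>
        (WithLp.toLp 2 fun i => (p.1 i : ℂ) + (p.2 i : ℂ) * Complex.I : CVec n)) =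
      Prod.map (fun p : Fin n → ℝ => (∑ i, x i * p i, ∑ i, r i * p i))
        (fun p : Fin n → ℝ => (∑ i, x i * p i, ∑ i, r i * p i)) := by
    ext p <;> simp [rePart, imPart, PiLp.inner_apply]
  rw [h2, ← Measure.map_prod_map _ _ (by fun_prop) (by fun_prop)]
  have h3 : (fun q : (ℝ × ℝ) × (ℝ × ℝ) =>
      ((‖x‖ * q.1.1, ‖r‖ * q.1.2), (‖x‖ * q.2.1, ‖r‖ * q.2.2))) =
      Prod.map (fun q : ℝ × ℝ => (‖x‖ * q.1, ‖r‖ * q.2))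
        (fun q : ℝ × ℝ => (‖x‖ * q.1, ‖r‖ * q.2)) := rfl
  rw [h3, fourGaussian, ← Measure.map_prod_map _ _ (by fun_prop) (by fun_prop), ← h1]

/-! ### One-dimensional Gaussian integrals -/

/-- The factor `exp (c x²)` turns the density of `N(0, 1/2)` into `√(2v)` times that of `N(0, v)`.
All the Gaussian exponential integrals below are instances. -/
theorem integral_mul_exp_halfGaussian (f : ℝ → ℝ) {c : ℝ} (v : NNReal) (hv : v ≠ 0)
    (hc : (1 - c) * (2 * v) = 1) :
    ∫ x, f x * Real.exp (c * x ^ 2) ∂halfGaussian = √(2 * v) * ∫ x, f x ∂(gaussianReal 0 v) := by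
  rw [integral_gaussianReal_eq_integral_smul (by norm_num),
    integral_gaussianReal_eq_integral_smul hv, ← integral_const_mul]
  refine integral_congr_ae (Filter.Eventually.of_forall fun x => ?_)
  have hv' : (0 : ℝ) < v := by positivity
  simp only [gaussianPDFReal, sub_zero, smul_eq_mul, NNReal.coe_div, NNReal.coe_one,
    NNReal.coe_ofNat]
  have h1 : √(2 * Real.pi * v) = √(2 * v) * √Real.pi := by
    rw [← Real.sqrt_mul (by positivity)]; ring_nf
  have h2 : √(2 * Real.pi * (1 / 2)) = √Real.pi := by ring_nf
  have h3 : -x ^ 2 / (2 * (v : ℝ)) = -x ^ 2 / (2 * (1 / 2)) + c * x ^ 2 := by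
    have : 1 / (2 * (v : ℝ)) = 1 - c := by field_simp; linarith
    rw [div_eq_mul_one_div, this]; ring
  rw [h1, h2, h3, Real.exp_add]
  have : 0 < √(2 * (v : ℝ)) := by positivity
  have : 0 < √Real.pi := by positivity
  field_simp

theorem integrable_pow_halfGaussian (k : ℕ) : Integrable (fun x => x ^ k) halfGaussian := by
  have h := (memLp_id_gaussianReal' (μ := 0) (v := 1 / 2) k (by simp)).integrable_norm_pow'
  rw [← integrable_norm_iff (by fun_prop)]
  simpa [halfGaussian] using h

theorem integral_sq_gaussianReal (v : NNReal) : ∫ x, x ^ 2 ∂(gaussianReal 0 v) = v := by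
  have h := variance_fun_id_gaussianReal (μ := 0) (v := v)
  rw [variance_eq_integral (by fun_prop)] at h
  simpa using h

theorem integral_exp_half_sq : ∫ x, Real.exp (x ^ 2 / 2) ∂halfGaussian = √2 := by
  have h := integral_mul_exp_halfGaussian (fun _ => 1) (c := 1 / 2) 1 one_ne_zero (by norm_num)
  simp only [one_mul, NNReal.coe_one, mul_one, integral_const, probReal_univ, smul_eq_mul] at h
  rw [← h]
  congr 1; ext x; ring_nf

theorem integrable_exp_half_sq : Integrable (fun x => Real.exp (x ^ 2 / 2)) halfGaussian := by
  -- The integral of a non-integrable function is `0` by convention, while this one equals `√2`.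
  by_contra h
  have := integral_undef h
  rw [integral_exp_half_sq] at this
  norm_num at this

theorem integral_exp_neg_sq : ∫ x, Real.exp (-x ^ 2) ∂halfGaussian = √(1 / 2) := by
  have h := integral_mul_exp_halfGaussian (fun _ => 1) (c := -1) (1 / 4) (by norm_num)
    (by push_cast; norm_num)
  simp only [one_mul, integral_const, probReal_univ, smul_eq_mul, mul_one, neg_mul] at h
  rw [h]; congr 1; push_cast; norm_num

theorem integral_sq_mul_exp_neg_sq :
    ∫ x, x ^ 2 * Real.exp (-x ^ 2) ∂halfGaussian = √(1 / 2) / 4 := by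
  have h := integral_mul_exp_halfGaussian (fun x => x ^ 2) (c := -1) (1 / 4) (by norm_num)
    (by push_cast; norm_num)
  simp only [neg_mul, one_mul, integral_sq_gaussianReal] at h
  rw [h]; push_cast; norm_num; ring

theorem integrable_pow_mul_exp_neg_sq (k : ℕ) :
    Integrable (fun x => x ^ k * Real.exp (-x ^ 2)) halfGaussian :=
  (integrable_pow_halfGaussian k).mono (by fun_prop) (Filter.Eventually.of_forall fun x => by
    rw [norm_mul, Real.norm_of_nonneg (Real.exp_pos _).le]
    exact mul_le_of_le_one_right (norm_nonneg _) (Real.exp_le_one_iff.2 (by nlinarith)))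

/-! ### Means of functions of four independent Gaussians -/

/-- `X` is integrable with mean `c`. -/
def HasMean {α : Type*} [MeasurableSpace α] (μ : Measure α) (X : α → ℝ) (c : ℝ) : Prop :=
  Integrable X μ ∧ ∫ a, X a ∂μ = c

namespace HasMean

variable {α : Type*} [MeasurableSpace α] {μ : Measure α} {X Y : α → ℝ} {c d : ℝ}

theorem add (hX : HasMean μ X c) (hY : HasMean μ Y d) :
    HasMean μ (fun a => X a + Y a) (c + d) :=
  ⟨hX.1.add hY.1, by rw [integral_add hX.1 hY.1, hX.2, hY.2]⟩

theorem sub (hX : HasMean μ X c) (hY : HasMean μ Y d) :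
    HasMean μ (fun a => X a - Y a) (c - d) :=
  ⟨hX.1.sub hY.1, by rw [integral_sub hX.1 hY.1, hX.2, hY.2]⟩

theorem const_mul (k : ℝ) (hX : HasMean μ X c) : HasMean μ (fun a => k * X a) (k * c) :=
  ⟨hX.1.const_mul k, by rw [integral_const_mul, hX.2]⟩

theorem congr (hX : HasMean μ X c) (h : ∀ a, X a = Y a) (hc : c = d) : HasMean μ Y d := by
  rwa [← hc, ← funext h]

theorem prod_four {f g f' g' : ℝ → ℝ} {a b a' b' : ℝ} (hf : HasMean halfGaussian f a)
    (hg : HasMean halfGaussian g b) (hf' : HasMean halfGaussian f' a')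
    (hg' : HasMean halfGaussian g' b') :
    HasMean fourGaussian (fun q => f q.1.1 * g q.1.2 * (f' q.2.1 * g' q.2.2))
      (a * b * (a' * b')) := by
  refine ⟨(hf.1.mul_prod hg.1).mul_prod (hf'.1.mul_prod hg'.1), ?_⟩
  rw [fourGaussian, integral_prod_mul (fun q : ℝ × ℝ => f q.1 * g q.2)
    (fun q : ℝ × ℝ => f' q.1 * g' q.2), integral_prod_mul, integral_prod_mul, hf.2, hg.2, hf'.2,
    hg'.2]

end HasMean

theorem hasMean_one : HasMean halfGaussian (fun _ => 1) 1 := ⟨integrable_const _, by simp⟩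

theorem hasMean_id : HasMean halfGaussian (fun x => x) 0 :=
  ⟨by simpa using integrable_pow_halfGaussian 1, integral_id_gaussianReal⟩

theorem hasMean_sq : HasMean halfGaussian (fun x => x ^ 2) (1 / 2) :=
  ⟨integrable_pow_halfGaussian 2, by rw [integral_sq_gaussianReal]; norm_num⟩

theorem hasMean_pow (k : ℕ) :
    HasMean halfGaussian (fun x => x ^ k) (∫ x, x ^ k ∂halfGaussian) :=
  ⟨integrable_pow_halfGaussian k, rfl⟩

/-- Jensen's inequality, from `(x² - 1/2)² ≥ 0`; the exact fourth moment is not needed. -/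
theorem quarter_le_integral_pow_four : 1 / 4 ≤ ∫ x, x ^ 4 ∂halfGaussian := by
  have h := ((hasMean_pow 4).sub hasMean_sq).add (hasMean_one.const_mul (1 / 4))
  have h2 : 0 ≤ ∫ x, (x ^ 4 - x ^ 2 + 1 / 4 * 1) ∂halfGaussian :=
    integral_nonneg fun x => by
      have : x ^ 4 - x ^ 2 + 1 / 4 * 1 = (x ^ 2 - 1 / 2) ^ 2 := by ring
      rw [this]; exact sq_nonneg _
  rw [h.2] at h2
  linarith

theorem hasMean_exp_neg_sq : HasMean halfGaussian (fun x => Real.exp (-x ^ 2)) (√(1 / 2)) :=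
  ⟨by simpa using integrable_pow_mul_exp_neg_sq 0, integral_exp_neg_sq⟩

/-- The value is irrelevant: this mean only occurs multiplied by the zero mean of another
coordinate. -/
theorem hasMean_mul_exp_neg_sq :
    HasMean halfGaussian (fun x => x * Real.exp (-x ^ 2))
      (∫ x, x * Real.exp (-x ^ 2) ∂halfGaussian) :=
  ⟨by simpa using integrable_pow_mul_exp_neg_sq 1, rfl⟩

theorem hasMean_sq_mul_exp_neg_sq :
    HasMean halfGaussian (fun x => x ^ 2 * Real.exp (-x ^ 2)) (√(1 / 2) / 4) :=
  ⟨integrable_pow_mul_exp_neg_sq 2, integral_sq_mul_exp_neg_sq⟩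

/-! ### The quadratic forms of a measurement -/

/-- `⟨a_R, v⟩² + ⟨a_I, v⟩²`. -/
noncomputable def energy {n : ℕ} (a : CVec n) (v : RVec n) : ℝ :=
  inner ℝ (rePart a) v ^ 2 + inner ℝ (imPart a) v ^ 2

/-- `⟨a_R, x⟩⟨a_R, v⟩ + ⟨a_I, x⟩⟨a_I, v⟩`. -/
noncomputable def corr {n : ℕ} (a : CVec n) (x v : RVec n) : ℝ :=
  inner ℝ (rePart a) x * inner ℝ (rePart a) v + inner ℝ (imPart a) x * inner ℝ (imPart a) v

@[fun_prop]
theorem measurable_energy {n : ℕ} (v : RVec n) : Measurable fun a : CVec n => energy a v := by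
  unfold energy; fun_prop

@[fun_prop]
theorem measurable_corr {n : ℕ} (x v : RVec n) : Measurable fun a : CVec n => corr a x v := by
  unfold corr; fun_prop

theorem energy_nonneg {n : ℕ} (a : CVec n) (v : RVec n) : 0 ≤ energy a v := by
  unfold energy; positivity

/-- Transfer of means from the Gaussian coordinates to the measurement. -/
theorem hasMean_of_coords {n : ℕ} {x r : RVec n} (h : inner ℝ x r = 0) {c : ℝ}
    {F : (ℝ × ℝ) × (ℝ × ℝ) → ℝ} (hF : Measurable F)
    (hm : HasMean fourGaussian
      (fun q => F ((‖x‖ * q.1.1, ‖r‖ * q.1.2), (‖x‖ * q.2.1, ‖r‖ * q.2.2))) c) :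
    HasMean (complexGaussian n) (fun a => F ((inner ℝ (rePart a) x, inner ℝ (rePart a) r),
      (inner ℝ (imPart a) x, inner ℝ (imPart a) r))) c := by
  have hl := map_coords_complexGaussian x r h
  have hA : Measurable fun a : CVec n => ((inner ℝ (rePart a) x, inner ℝ (rePart a) r),
      (inner ℝ (imPart a) x, inner ℝ (imPart a) r)) := by fun_prop
  have hB : Measurable fun q : (ℝ × ℝ) × (ℝ × ℝ) =>
      ((‖x‖ * q.1.1, ‖r‖ * q.1.2), (‖x‖ * q.2.1, ‖r‖ * q.2.2)) := by fun_prop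
  constructor
  · have h1 := (integrable_map_measure (f := _) (μ := fourGaussian)
      hF.aestronglyMeasurable hB.aemeasurable).2 hm.1
    rw [← hl] at h1
    exact (integrable_map_measure hF.aestronglyMeasurable hA.aemeasurable).1 h1
  · rw [← hm.2, ← integral_map hA.aemeasurable hF.aestronglyMeasurable, hl,
      integral_map hB.aemeasurable hF.aestronglyMeasurable]

/-- At norm one, the exponential moment factors into two integrals equal to `√2`; a smaller norm
only decreases it. This subexponential bound is the source of all later moment bounds. -/
theorem integrable_exp_half_energy_and_le {n : ℕ} (v : RVec n) (hv : ‖v‖ ≤ 1) :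
    Integrable (fun a => Real.exp (energy a v / 2)) (complexGaussian n) ∧
      ∫ a, Real.exp (energy a v / 2) ∂(complexGaussian n) ≤ 2 := by
  have hE : HasMean halfGaussian (fun x => Real.exp (x ^ 2 / 2)) (√2) :=
    ⟨integrable_exp_half_sq, integral_exp_half_sq⟩
  have h4 := (hE.prod_four hasMean_one hE hasMean_one).congr
    (Y := fun q => Real.exp ((q.1.1 ^ 2 + q.2.1 ^ 2) / 2)) (d := 2)
    (fun q => by rw [mul_one, mul_one, ← Real.exp_add]; ring_nf) (by simp)
  have hle : ∀ q : (ℝ × ℝ) × (ℝ × ℝ), Real.exp (((‖v‖ * q.1.1) ^ 2 + (‖v‖ * q.2.1) ^ 2) / 2) ≤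
      Real.exp ((q.1.1 ^ 2 + q.2.1 ^ 2) / 2) := fun q => by
    have : ‖v‖ ^ 2 ≤ 1 := pow_le_one₀ (norm_nonneg _) hv
    apply Real.exp_le_exp.2
    rw [mul_pow, mul_pow]
    nlinarith [sq_nonneg q.1.1, sq_nonneg q.2.1]
  have hint : Integrable (fun q : (ℝ × ℝ) × (ℝ × ℝ) =>
      Real.exp (((‖v‖ * q.1.1) ^ 2 + (‖v‖ * q.2.1) ^ 2) / 2)) fourGaussian :=
    h4.1.mono' (Measurable.aestronglyMeasurable (by fun_prop))
      (Filter.Eventually.of_forall fun q => by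
      rw [Real.norm_of_nonneg (Real.exp_pos _).le]; exact hle q)
  have := hasMean_of_coords (x := v) (r := 0) (by simp)
    (F := fun t => Real.exp ((t.1.1 ^ 2 + t.2.1 ^ 2) / 2)) (by fun_prop) ⟨hint, rfl⟩
  exact ⟨this.1, this.2.trans_le ((integral_mono hint h4.1 hle).trans_eq h4.2)⟩

theorem pow_le_factorial_mul_exp_half {y : ℝ} (hy : 0 ≤ y) (k : ℕ) :
    y ^ k ≤ 2 ^ k * k.factorial * Real.exp (y / 2) := by
  have h := Real.pow_div_factorial_le_exp (y / 2) (by positivity) k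
  rw [div_le_iff₀ (by positivity), div_pow, div_le_iff₀ (by positivity)] at h
  linarith

theorem integrable_energy_pow_and_le {n : ℕ} (v : RVec n) (hv : ‖v‖ ≤ 1) (k : ℕ) :
    Integrable (fun a => energy a v ^ k) (complexGaussian n) ∧
      ∫ a, energy a v ^ k ∂(complexGaussian n) ≤ 2 ^ k * k.factorial * 2 := by
  obtain ⟨h1, h2⟩ := integrable_exp_half_energy_and_le v hv
  have hi : Integrable (fun a => energy a v ^ k) (complexGaussian n) :=
    (h1.const_mul (2 ^ k * (k.factorial : ℝ))).mono'
      (Measurable.aestronglyMeasurable (by fun_prop)) (Filter.Eventually.of_forall fun a => by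
        rw [Real.norm_of_nonneg (pow_nonneg (energy_nonneg _ _) _)]
        exact pow_le_factorial_mul_exp_half (energy_nonneg _ _) k)
  refine ⟨hi, (integral_mono hi (h1.const_mul (2 ^ k * (k.factorial : ℝ)))
    fun a => pow_le_factorial_mul_exp_half (energy_nonneg a v) k).trans ?_⟩
  rw [integral_const_mul]
  gcongr

theorem hasMean_energy {n : ℕ} (z : RVec n) (hz : ‖z‖ = 1) :
    HasMean (complexGaussian n) (fun a => energy a z) 1 := by
  refine hasMean_of_coords (x := z) (r := 0) (by simp)
    (F := fun t => t.1.1 ^ 2 + t.2.1 ^ 2) (by fun_prop) ?_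
  refine ((hasMean_sq.prod_four hasMean_one hasMean_one hasMean_one).add
    (hasMean_one.prod_four hasMean_one hasMean_sq hasMean_one)).congr (fun q => ?_) (by norm_num)
  simp [hz]

theorem exists_orthogonal_decomposition {n : ℕ} (z v : RVec n) (hz : ‖z‖ = 1) :
    ∃ r : RVec n, v = (inner ℝ v z : ℝ) • z + r ∧ inner ℝ z r = 0 ∧
      ‖v‖ ^ 2 = (inner ℝ v z : ℝ) ^ 2 + ‖r‖ ^ 2 := by
  have hzz : inner ℝ z z = (1 : ℝ) := by rw [real_inner_self_eq_norm_sq, hz, one_pow]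
  have ho : inner ℝ z (v - (inner ℝ v z : ℝ) • z) = 0 := by
    rw [inner_sub_right, inner_smul_right, hzz, real_inner_comm]; ring
  refine ⟨v - (inner ℝ v z : ℝ) • z, by abel, ho, ?_⟩
  have h : v = (inner ℝ v z : ℝ) • z + (v - (inner ℝ v z : ℝ) • z) := by abel
  have h2 := norm_add_sq_eq_norm_sq_add_norm_sq_real (x := (inner ℝ v z : ℝ) • z)
    (y := v - (inner ℝ v z : ℝ) • z) (by rw [inner_smul_left, ho, mul_zero])
  rw [← h] at h2
  rw [pow_two, h2, norm_smul, hz, Real.norm_eq_abs, mul_one, abs_mul_abs_self]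
  ring

/-- Write `v = α z + r` with `r ⟂ z`. The `‖r‖²` term is multiplied by the mean of the weight, `1/2
- 1/2 = 0`; the cross term is odd; the `α²` term contributes `1/2 - 1/4`. -/
theorem hasMean_weighted_energy {n : ℕ} (z v : RVec n) (hz : ‖z‖ = 1) :
    HasMean (complexGaussian n)
      (fun a => (1 / 2 - Real.exp (-energy a z)) * energy a v) ((inner ℝ v z : ℝ) ^ 2 / 4) := by
  obtain ⟨r, hv, hr, -⟩ := exists_orthogonal_decomposition z v hz
  set α : ℝ := inner ℝ v z
  have hm := hasMean_of_coords (x := z) (r := r) hr (c := α ^ 2 / 4)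
    (F := fun t => (1 / 2 - Real.exp (-(t.1.1 ^ 2 + t.2.1 ^ 2))) *
      ((α * t.1.1 + t.1.2) ^ 2 + (α * t.2.1 + t.2.2) ^ 2)) (by fun_prop) ?_
  · refine hm.congr (fun a => ?_) rfl
    simp only [energy]
    rw [hv, inner_add_right, inner_add_right, inner_smul_right, inner_smul_right]
  have o := hasMean_one
  have i := hasMean_id
  have s := hasMean_sq
  have e := hasMean_exp_neg_sq
  have ie := hasMean_mul_exp_neg_sq
  have se := hasMean_sq_mul_exp_neg_sq
  -- The integrand is expanded into products of functions of single coordinates, grouped by `α²`, `α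
  -- ‖r‖` and `‖r‖²`.
  refine ((((((((s.prod_four o o o).add (o.prod_four o s o)).const_mul (α ^ 2 / 2)).sub
    (((se.prod_four o e o).add (e.prod_four o se o)).const_mul (α ^ 2))).add
    (((i.prod_four i o o).add (o.prod_four o i i)).const_mul (α * ‖r‖))).sub
    (((ie.prod_four i e o).add (e.prod_four o ie i)).const_mul (2 * α * ‖r‖))).add
    (((o.prod_four s o o).add (o.prod_four o o s)).const_mul (‖r‖ ^ 2 / 2))).sub
    (((e.prod_four s e o).add (e.prod_four o e s)).const_mul (‖r‖ ^ 2))).congr (fun q => ?_) ?_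
  · rw [hz, neg_add, Real.exp_add]
    simp only [one_mul]
    ring
  · have : √(1 / 2 : ℝ) ^ 2 = 1 / 2 := Real.sq_sqrt (by norm_num)
    linear_combination (-α ^ 2 / 2 - ‖r‖ ^ 2) * this

/-- With `v = α x + r` the mean is `α² (2 E t⁴ + 1/2) + ‖r‖² / 2`. It is positive definite in `v`,
which makes the normal matrix invertible. -/
theorem exists_hasMean_corr_sq {n : ℕ} (x v : RVec n) (hx : ‖x‖ = 1) :
    ∃ c, ‖v‖ ^ 2 / 2 ≤ c ∧ HasMean (complexGaussian n) (fun a => corr a x v ^ 2) c := by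
  obtain ⟨r, hv, hr, hn⟩ := exists_orthogonal_decomposition x v hx
  set α : ℝ := inner ℝ v x
  set m := ∫ x, x ^ 4 ∂halfGaussian
  have hm4 : 1 / 4 ≤ m := quarter_le_integral_pow_four
  refine ⟨α ^ 2 * (2 * m + 1 / 2) + ‖r‖ ^ 2 / 2, ?_, ?_⟩
  · rw [hn]; nlinarith [sq_nonneg α]
  have hm := hasMean_of_coords (x := x) (r := r) hr (c := α ^ 2 * (2 * m + 1 / 2) + ‖r‖ ^ 2 / 2)
    (F := fun t => (t.1.1 * (α * t.1.1 + t.1.2) + t.2.1 * (α * t.2.1 + t.2.2)) ^ 2)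
    (by fun_prop) ?_
  · refine hm.congr (fun a => ?_) rfl
    simp only [corr]
    rw [hv, inner_add_right, inner_add_right, inner_smul_right, inner_smul_right]
  have o := hasMean_one
  have i := hasMean_id
  have s := hasMean_sq
  have c := hasMean_pow 3
  have f := hasMean_pow 4
  refine (((((((f.prod_four o o o).add (o.prod_four o f o)).add
    ((s.prod_four o s o).const_mul 2)).const_mul (α ^ 2)).add
    ((((c.prod_four i o o).add (i.prod_four i s o)).add
      ((s.prod_four o i i).add (o.prod_four o c i))).const_mul (2 * α * ‖r‖))).add
    (((s.prod_four s o o).add (o.prod_four o s s)).const_mul (‖r‖ ^ 2))).add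
    ((i.prod_four i i i).const_mul (2 * ‖r‖ ^ 2))).congr (fun q => ?_) ?_
  · rw [hx]; ring
  · ring

/-- Cauchy–Schwarz in the plane, through Lagrange's identity. -/
theorem corr_sq_le {n : ℕ} (a : CVec n) (x v : RVec n) :
    corr a x v ^ 2 ≤ energy a x * energy a v := by
  unfold corr energy
  nlinarith [sq_nonneg ((inner ℝ (rePart a) x : ℝ) * inner ℝ (imPart a) v -
    inner ℝ (imPart a) x * inner ℝ (rePart a) v)]

theorem integrable_corr_pow_four_and_le {n : ℕ} (x v : RVec n) (hx : ‖x‖ ≤ 1) (hv : ‖v‖ ≤ 1) :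
    Integrable (fun a => (corr a x v ^ 2) ^ 2) (complexGaussian n) ∧
      ∫ a, (corr a x v ^ 2) ^ 2 ∂(complexGaussian n) ≤ 1536 := by
  obtain ⟨h1, h2⟩ := integrable_energy_pow_and_le x hx 4
  obtain ⟨h3, h4⟩ := integrable_energy_pow_and_le v hv 4
  have hle : ∀ a : CVec n, (corr a x v ^ 2) ^ 2 ≤ energy a x ^ 4 + energy a v ^ 4 := fun a => by
    have h5 : (corr a x v ^ 2) ^ 2 ≤ (energy a x * energy a v) ^ 2 :=
      pow_le_pow_left₀ (sq_nonneg _) (corr_sq_le a x v) 2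
    nlinarith [sq_nonneg (energy a x ^ 2 - energy a v ^ 2), sq_nonneg (energy a x ^ 2),
      sq_nonneg (energy a v ^ 2)]
  have hi : Integrable (fun a => (corr a x v ^ 2) ^ 2) (complexGaussian n) :=
    (h1.add h3).mono' (Measurable.aestronglyMeasurable (by fun_prop))
      (Filter.Eventually.of_forall fun a => by
        rw [Real.norm_of_nonneg (by positivity)]; exact hle a)
  refine ⟨hi, (integral_mono hi (h1.add h3) hle).trans ?_⟩
  simp only [Pi.add_apply]
  rw [integral_add h1 h3]
  norm_num [Nat.factorial] at h2 h4
  linarith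

theorem norm_sq_eq_sum_energy {n : ℕ} (a : CVec n) :
    ‖a‖ ^ 2 = ∑ i, energy a (EuclideanSpace.single i 1) := by
  rw [EuclideanSpace.norm_sq_eq]
  refine Finset.sum_congr rfl fun i _ => ?_
  rw [Complex.sq_norm, Complex.normSq_apply]
  simp [energy, rePart, imPart, EuclideanSpace.inner_single_right]
  ring

theorem integrable_norm_pow_four_and_le (n : ℕ) :
    Integrable (fun a => ‖a‖ ^ 4) (complexGaussian n) ∧
      ∫ a, ‖a‖ ^ 4 ∂(complexGaussian n) ≤ 16 * n ^ 2 := by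
  have h1 : ∀ i : Fin n, _ := fun i =>
    integrable_energy_pow_and_le (EuclideanSpace.single i (1 : ℝ)) (by simp) 2
  have hle : ∀ a : CVec n, ‖a‖ ^ 4 ≤ n * ∑ i, energy a (EuclideanSpace.single i 1) ^ 2 := fun a => by
    have := sq_sum_le_card_mul_sum_sq (s := (Finset.univ : Finset (Fin n)))
      (f := fun i => energy a (EuclideanSpace.single i 1))
    rw [← norm_sq_eq_sum_energy, Finset.card_univ, Fintype.card_fin] at this
    calc ‖a‖ ^ 4 = (‖a‖ ^ 2) ^ 2 := by ring
      _ ≤ _ := this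
  have hs : Integrable (fun a : CVec n => n * ∑ i, energy a (EuclideanSpace.single i 1) ^ 2)
      (complexGaussian n) :=
    (integrable_finsetSum _ fun i _ => (h1 i).1).const_mul _
  have hi : Integrable (fun a => ‖a‖ ^ 4) (complexGaussian n) :=
    hs.mono' (Measurable.aestronglyMeasurable (by fun_prop))
      (Filter.Eventually.of_forall fun a => by
        rw [Real.norm_of_nonneg (by positivity)]; exact hle a)
  refine ⟨hi, (integral_mono hi hs hle).trans ?_⟩
  rw [integral_const_mul, integral_finsetSum _ fun i _ => (h1 i).1]
  have : ∑ i : Fin n, ∫ a, energy a (EuclideanSpace.single i 1) ^ 2 ∂(complexGaussian n) ≤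
      ∑ _i : Fin n, (16 : ℝ) :=
    Finset.sum_le_sum fun i _ => (h1 i).2.trans (by norm_num [Nat.factorial])
  simp only [Finset.sum_const, Finset.card_univ, Fintype.card_fin, nsmul_eq_mul] at this
  calc (n : ℝ) * _ ≤ n * (n * 16) := by gcongr
    _ = _ := by ring

/-! ### Exponential moments and Chernoff bounds -/

section Chernoff

variable {α : Type*} [MeasurableSpace α] {μ : Measure α}

/-- The exponential moment of `g` at `s` is finite and at most `q`. -/
def ExpMomentLE (μ : Measure α) (s q : ℝ) (g : α → ℝ) : Prop :=
  Integrable (fun a => Real.exp (s * g a)) μ ∧ ∫ a, Real.exp (s * g a) ∂μ ≤ q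

/-- Chernoff's bound for i.i.d. samples. The threshold is absorbed into `g`, so the relevant event
is that the sum is nonnegative. -/
theorem ExpMomentLE.pi_sum_nonneg_le [IsProbabilityMeasure μ] {s q : ℝ} {g : α → ℝ}
    (h : ExpMomentLE μ s q g) (hs : 0 ≤ s) (m : ℕ) :
    (Measure.pi fun _ : Fin m => μ).real {b | 0 ≤ ∑ j, g (b j)} ≤ q ^ m := by
  have hprod : ∀ b : Fin m → α, Real.exp (s * ∑ j, g (b j)) = ∏ j, Real.exp (s * g (b j)) :=
    fun b => by rw [Finset.mul_sum, Real.exp_sum]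
  have hi : Integrable (fun b : Fin m → α => Real.exp (s * ∑ j, g (b j)))
      (Measure.pi fun _ : Fin m => μ) := by
    simp_rw [hprod]
    exact Integrable.fintype_prod (f := fun _ a => Real.exp (s * g a)) fun _ => h.1
  refine (measure_ge_le_exp_mul_mgf (X := fun b : Fin m → α => ∑ j, g (b j)) 0 hs hi).trans ?_
  rw [mul_zero, Real.exp_zero, one_mul, mgf]
  simp_rw [hprod]
  rw [integral_fintype_prod_eq_pow (fun a => Real.exp (s * g a)), Fintype.card_fin]
  exact pow_le_pow_left₀ (integral_nonneg fun a => (Real.exp_pos _).le) h.2 m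

theorem exp_le_one_add_add_sq_mul (u : ℝ) :
    Real.exp u ≤ 1 + u + u ^ 2 * Real.exp |u| := by
  have h := Complex.norm_exp_sub_sum_le_norm_mul_exp (u : ℂ) 2
  simp only [Finset.sum_range_succ, Finset.sum_range_zero, pow_zero, Nat.factorial, pow_one,
    Nat.cast_one, div_one, zero_add, mul_one] at h
  rw [Complex.norm_real, ← Complex.ofReal_exp, ← Complex.ofReal_one, ← Complex.ofReal_add,
    ← Complex.ofReal_sub, Complex.norm_real, Real.norm_eq_abs, Real.norm_eq_abs, sq_abs] at h
  linarith [(abs_le.1 h).2]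

theorem exp_neg_le_one_sub_add_sq {u : ℝ} (hu : 0 ≤ u) : Real.exp (-u) ≤ 1 - u + u ^ 2 := by
  have h1 := Real.add_one_le_exp u
  rw [Real.exp_neg, inv_le_iff_one_le_mul₀ (Real.exp_pos u)]
  calc (1 : ℝ) ≤ 1 + u ^ 3 := by linarith [pow_nonneg hu 3]
    _ = (1 - u + u ^ 2) * (u + 1) := by ring
    _ ≤ (1 - u + u ^ 2) * Real.exp u := by
      gcongr
      nlinarith [sq_nonneg (u - 1)]

theorem hasMean_const [IsProbabilityMeasure μ] {c : ℝ} : HasMean μ (fun _ => c) c :=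
  ⟨integrable_const _, by simp⟩

/-- The exponential moment of a centred sub-exponential variable. -/
theorem expMomentLE_of_abs_le [IsProbabilityMeasure μ] {X Y : α → ℝ} {c s t : ℝ}
    (hX : HasMean μ X c) (hXY : ∀ a, |X a| ≤ Y a)
    (hY : ExpMomentLE μ (1 / 2) 2 Y) (hs : 0 ≤ s) (hs' : s ≤ 1 / 4) :
    ExpMomentLE μ s (Real.exp (s * (c - t) + 64 * s ^ 2)) (fun a => X a - t) := by
  have hpt : ∀ a, Real.exp (s * X a) ≤ 1 + s * X a + 32 * s ^ 2 * Real.exp (1 / 2 * Y a) :=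
    fun a => by
    refine (exp_le_one_add_add_sq_mul _).trans ?_
    have hY0 : 0 ≤ Y a := (abs_nonneg _).trans (hXY a)
    have h1 : (s * X a) ^ 2 ≤ s ^ 2 * Y a ^ 2 := by
      rw [mul_pow]
      exact mul_le_mul_of_nonneg_left (sq_le_sq' (by linarith [neg_abs_le (X a), hXY a])
        ((le_abs_self _).trans (hXY a))) (sq_nonneg s)
    -- The available `exp (Y / 2)` is split in two: one factor `exp (Y / 4)` pays for `exp |s X|`,
    -- which is why `s ≤ 1/4`, and the other for `Y²`.
    have h2 : Real.exp |s * X a| ≤ Real.exp (Y a / 4) := by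
      rw [abs_mul, abs_of_nonneg hs]
      exact Real.exp_le_exp.2 (by nlinarith [hXY a, abs_nonneg (X a)])
    have h3 : Y a ^ 2 ≤ 32 * Real.exp (Y a / 4) := by
      have := pow_le_factorial_mul_exp_half (y := Y a / 2) (by positivity) 2
      norm_num [Nat.factorial] at this
      have h4 : Y a / 2 / 2 = Y a / 4 := by ring
      rw [h4] at this
      linarith
    have h5 : Real.exp (1 / 2 * Y a) = Real.exp (Y a / 4) * Real.exp (Y a / 4) := by
      rw [← Real.exp_add]; ring_nf
    have h6 : (s * X a) ^ 2 * Real.exp |s * X a| ≤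
        s ^ 2 * (32 * Real.exp (Y a / 4)) * Real.exp (Y a / 4) :=
      mul_le_mul (h1.trans (by gcongr)) h2 (Real.exp_pos _).le (by positivity)
    rw [h5]
    linarith
  have hint : Integrable (fun a => 1 + s * X a + 32 * s ^ 2 * Real.exp (1 / 2 * Y a)) μ :=
    ((integrable_const _).add (hX.1.const_mul _)).add (hY.1.const_mul _)
  have hi : Integrable (fun a => Real.exp (s * X a)) μ :=
    hint.mono' (Real.measurable_exp.comp_aemeasurable
      (hX.1.aemeasurable.const_mul s)).aestronglyMeasurable
      (Filter.Eventually.of_forall fun a => by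
        rw [Real.norm_of_nonneg (Real.exp_pos _).le]; exact hpt a)
  have heq : ∀ a, Real.exp (s * (X a - t)) = Real.exp (-(s * t)) * Real.exp (s * X a) :=
    fun a => by rw [← Real.exp_add]; ring_nf
  have hle : ∫ a, Real.exp (s * X a) ∂μ ≤ Real.exp (s * c + 64 * s ^ 2) := by
    refine (integral_mono hi hint hpt).trans ?_
    rw [((hasMean_const.add (hX.const_mul s)).add
      (HasMean.const_mul (32 * s ^ 2) ⟨hY.1, rfl⟩)).2]
    have := Real.add_one_le_exp (s * c + 64 * s ^ 2)
    have h2 : 32 * s ^ 2 * ∫ a, Real.exp (1 / 2 * Y a) ∂μ ≤ 32 * s ^ 2 * 2 := by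
      gcongr; exact hY.2
    linarith
  unfold ExpMomentLE
  simp_rw [heq]
  refine ⟨hi.const_mul _, ?_⟩
  rw [integral_const_mul]
  calc Real.exp (-(s * t)) * ∫ a, Real.exp (s * X a) ∂μ
      ≤ Real.exp (-(s * t)) * Real.exp (s * c + 64 * s ^ 2) := by gcongr
    _ = _ := by rw [← Real.exp_add]; ring_nf

/-- The lower tail of a nonnegative square-integrable variable. -/
theorem expMomentLE_const_sub [IsProbabilityMeasure μ] {X : α → ℝ} {c K s t : ℝ}
    (hX : HasMean μ X c) (hX0 : ∀ a, 0 ≤ X a) (hX2 : Integrable (fun a => X a ^ 2) μ)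
    (hK : ∫ a, X a ^ 2 ∂μ ≤ K) (hs : 0 ≤ s) :
    ExpMomentLE μ s (Real.exp (s * (t - c) + K * s ^ 2)) (fun a => t - X a) := by
  -- For nonnegative variables the second-order bound on `exp (-u)` has no exponential remainder, so
  -- two moments are enough for the lower tail.
  have hpt : ∀ a, Real.exp (-(s * X a)) ≤ 1 - s * X a + s ^ 2 * X a ^ 2 := fun a => by
    rw [← mul_pow]; exact exp_neg_le_one_sub_add_sq (mul_nonneg hs (hX0 a))
  have hint : Integrable (fun a => 1 - s * X a + s ^ 2 * X a ^ 2) μ :=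
    ((integrable_const _).sub (hX.1.const_mul _)).add (hX2.const_mul _)
  have hi : Integrable (fun a => Real.exp (-(s * X a))) μ :=
    hint.mono' (Real.measurable_exp.comp_aemeasurable
      (hX.1.aemeasurable.const_mul s).neg).aestronglyMeasurable
      (Filter.Eventually.of_forall fun a => by
        rw [Real.norm_of_nonneg (Real.exp_pos _).le]; exact hpt a)
  have heq : ∀ a, Real.exp (s * (t - X a)) = Real.exp (s * t) * Real.exp (-(s * X a)) :=
    fun a => by rw [← Real.exp_add]; ring_nf
  have hle : ∫ a, Real.exp (-(s * X a)) ∂μ ≤ Real.exp (-(s * c) + K * s ^ 2) := by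
    refine (integral_mono hi hint hpt).trans ?_
    rw [((hasMean_const.sub (hX.const_mul s)).add (HasMean.const_mul (s ^ 2) ⟨hX2, rfl⟩)).2]
    have := Real.add_one_le_exp (-(s * c) + K * s ^ 2)
    have h2 : s ^ 2 * ∫ a, X a ^ 2 ∂μ ≤ s ^ 2 * K := by gcongr
    linarith
  unfold ExpMomentLE
  simp_rw [heq]
  refine ⟨hi.const_mul _, ?_⟩
  rw [integral_const_mul]
  calc Real.exp (s * t) * ∫ a, Real.exp (-(s * X a)) ∂μ
      ≤ Real.exp (s * t) * Real.exp (-(s * c) + K * s ^ 2) := by gcongr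
    _ = _ := by rw [← Real.exp_add]; ring_nf

end Chernoff

/-! ### A grid in the unit ball -/

/-- Rounding toward zero keeps the rounded vector inside the unit ball. -/
theorem exists_int_toward_zero (N : ℕ) (hN : 0 < N) (t : ℝ) :
    ∃ k : ℤ, |(k : ℝ) / N| ≤ |t| ∧ |t - k / N| ≤ 1 / N := by
  have hN' : (0 : ℝ) < N := by exact_mod_cast hN
  rcases le_total 0 t with ht | ht
  · refine ⟨⌊t * N⌋, ?_, ?_⟩
    · have h0 : (0 : ℝ) ≤ ⌊t * N⌋ := by exact_mod_cast Int.floor_nonneg.2 (by positivity)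
      rw [abs_of_nonneg (by positivity), abs_of_nonneg ht, div_le_iff₀ hN']
      exact Int.floor_le _
    · have h1 := Int.floor_le (t * N)
      have h2 := Int.lt_floor_add_one (t * N)
      have : t - ⌊t * N⌋ / N = (t * N - ⌊t * N⌋) / N := by field_simp
      rw [this, abs_div, abs_of_pos hN', abs_of_nonneg (by linarith)]
      gcongr; linarith
  · refine ⟨⌈t * N⌉, ?_, ?_⟩
    · have h0 : (⌈t * N⌉ : ℝ) ≤ 0 := by
        exact_mod_cast Int.ceil_le.2 (by push_cast; exact mul_nonpos_of_nonpos_of_nonneg ht hN'.le)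
      rw [abs_of_nonpos (div_nonpos_of_nonpos_of_nonneg h0 hN'.le), abs_of_nonpos ht, neg_le_neg_iff,
        le_div_iff₀ hN']
      exact Int.le_ceil _
    · have h1 := Int.le_ceil (t * N)
      have h2 := Int.ceil_lt_add_one (t * N)
      have : t - ⌈t * N⌉ / N = (t * N - ⌈t * N⌉) / N := by field_simp
      rw [this, abs_div, abs_of_pos hN', abs_of_nonpos (by linarith)]
      gcongr; linarith

theorem exists_grid (n N : ℕ) (hN : 0 < N) :
    ∃ S : Finset (RVec n), S.card ≤ (2 * N + 1) ^ n ∧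
      ∀ v : RVec n, ‖v‖ ≤ 1 → ∃ w ∈ S, ‖w‖ ≤ ‖v‖ ∧ ‖v - w‖ ≤ n / N := by
  classical
  have hN' : (0 : ℝ) < N := by exact_mod_cast hN
  let f : (Fin n → ℤ) → RVec n := fun k => WithLp.toLp 2 fun i => (k i : ℝ) / N
  refine ⟨(Fintype.piFinset fun _ : Fin n => Finset.Icc (-N : ℤ) N).image f, ?_, fun v hv => ?_⟩
  · refine Finset.card_image_le.trans ?_
    rw [Fintype.card_piFinset_const, Int.card_Icc]
    apply le_of_eq
    congr 1
    omega
  choose k hk1 hk2 using fun i => exists_int_toward_zero N hN (v i)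
  have hnorm : ‖f k‖ ≤ ‖v‖ := by
    rw [EuclideanSpace.norm_eq, EuclideanSpace.norm_eq]
    gcongr with i
    exact hk1 i
  refine ⟨f k, Finset.mem_image_of_mem _ (Fintype.mem_piFinset.2 fun i => ?_), hnorm, ?_⟩
  · have h1 : |(k i : ℝ) / N| ≤ 1 :=
      (hk1 i).trans (((Real.norm_eq_abs (v i)).symm.trans_le (PiLp.norm_apply_le v i)).trans hv)
    rw [abs_div, abs_of_pos hN', div_le_one hN'] at h1
    rw [Finset.mem_Icc]
    have := abs_le.1 h1
    exact ⟨by exact_mod_cast this.1, by exact_mod_cast this.2⟩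
  · have h2 : ‖v - f k‖ ^ 2 ≤ (n / N : ℝ) ^ 2 := by
      rw [EuclideanSpace.norm_sq_eq]
      calc ∑ i, ‖(v - f k) i‖ ^ 2 ≤ ∑ _i : Fin n, (1 / N : ℝ) ^ 2 := by
            gcongr with i
            exact hk2 i
        _ = n * (1 / N : ℝ) ^ 2 := by simp
        _ ≤ (n : ℝ) ^ 2 * (1 / N : ℝ) ^ 2 := by
            gcongr
            have : n ≤ n ^ 2 := Nat.le_self_pow two_ne_zero n
            exact_mod_cast this
        _ = _ := by ring
    exact le_of_sq_le_sq h2 (by positivity)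

theorem exists_sample_size_grid {B q τ : ℝ} (hB : 1 ≤ B) (hq : 0 < q) (hq1 : q < 1) (hτ : 0 < τ) :
    ∃ C > 0, ∀ n m : ℕ, 2 ≤ n → C * (n * Real.log n) ≤ m →
      (B * (n : ℝ) ^ 5) ^ n * q ^ m ≤ τ / (n : ℝ) ^ 2 := by
  have hl : 0 < -Real.log q := by linarith [Real.log_neg hq hq1]
  have h2 : 0 < Real.log 2 := Real.log_pos one_lt_two
  have hB0 := Real.log_nonneg hB
  -- After taking logarithms, `7 = 5 + 2` accounts for `n ^ 5` and `n ^ 2`; dividing by `log 2 ≤ log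
  -- n` turns the constants into multiples of `n log n`.
  refine ⟨(Real.log B / Real.log 2 + 7 + |Real.log τ| / Real.log 2) / (-Real.log q),
    by positivity, fun n m hn hm => ?_⟩
  have hn' : (2 : ℝ) ≤ n := by exact_mod_cast hn
  have hn0 : (0 : ℝ) < n := by linarith
  have hln : Real.log 2 ≤ Real.log n := Real.log_le_log two_pos hn'
  rw [div_mul_eq_mul_div, div_le_iff₀ hl] at hm
  rw [← Real.log_le_log_iff (by positivity) (by positivity), Real.log_mul (by positivity)
    (by positivity), Real.log_pow, Real.log_pow, Real.log_mul (by positivity) (by positivity),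
    Real.log_pow, Real.log_div (by positivity) (by positivity), Real.log_pow]
  push_cast
  have e1 : n * Real.log B ≤ Real.log B / Real.log 2 * (n * Real.log n) := by
    have : n * Real.log B = Real.log B / Real.log 2 * (n * Real.log 2) := by field_simp
    rw [this]; gcongr
  have e2 : |Real.log τ| ≤ |Real.log τ| / Real.log 2 * (n * Real.log n) := by
    have : |Real.log τ| = |Real.log τ| / Real.log 2 * (1 * Real.log 2) := by field_simp
    rw [this]; gcongr
    · linarith
    · linarith
  have e3 : 2 * Real.log n ≤ 2 * (n * Real.log n) := by nlinarith
  have e4 := neg_abs_le (Real.log τ)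
  nlinarith

/-! ### Uniform bounds on the sphere -/

theorem integrable_comp_eval_pi {α : Type*} [MeasurableSpace α] {μ : Measure α}
    [IsProbabilityMeasure μ] {f : α → ℝ} (hf : Integrable f μ) {m : ℕ} (j : Fin m) :
    Integrable (fun b : Fin m → α => f (b j)) (Measure.pi fun _ : Fin m => μ) :=
  (measurePreserving_eval (fun _ : Fin m => μ) j).integrable_comp_of_integrable hf

/-- Markov's inequality. It controls the random Lipschitz constant, and a bound polynomial in `n` is
enough because the grid can be polynomially fine. -/
theorem pi_sum_norm_pow_four_le {n m : ℕ} (hn : 1 ≤ n) {R : ℝ} (hR : 0 < R) :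
    (Measure.pi fun _ : Fin m => complexGaussian n).real
      {b | R * m < ∑ j, (1 + ‖b j‖ ^ 4)} ≤ 17 * (n : ℝ) ^ 2 / R := by
  rcases Nat.eq_zero_or_pos m with rfl | hm
  · simp; positivity
  have hm' : (0 : ℝ) < m := by exact_mod_cast hm
  obtain ⟨h1, h2⟩ := integrable_norm_pow_four_and_le n
  have hf : Integrable (fun a : CVec n => 1 + ‖a‖ ^ 4) (complexGaussian n) :=
    (integrable_const _).add h1
  have hfi : ∫ a, (1 + ‖a‖ ^ 4) ∂(complexGaussian n) ≤ 17 * (n : ℝ) ^ 2 := by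
    rw [integral_add (integrable_const _) h1]
    have : (1 : ℝ) ≤ n := by exact_mod_cast hn
    simp only [integral_const, probReal_univ, smul_eq_mul, mul_one]
    nlinarith
  have hi : Integrable (fun b : Fin m → CVec n => ∑ j, (1 + ‖b j‖ ^ 4))
      (Measure.pi fun _ : Fin m => complexGaussian n) :=
    integrable_finsetSum _ fun j _ => integrable_comp_eval_pi hf j
  have hint : ∫ b, ∑ j, (1 + ‖b j‖ ^ 4) ∂(Measure.pi fun _ : Fin m => complexGaussian n) ≤
      m * (17 * (n : ℝ) ^ 2) := by
    rw [integral_finsetSum _ fun j _ => integrable_comp_eval_pi hf j]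
    calc _ ≤ ∑ _j : Fin m, 17 * (n : ℝ) ^ 2 := Finset.sum_le_sum fun j _ => by
          rw [integral_comp_eval (μ := fun _ : Fin m => complexGaussian n)
            (f := fun a => 1 + ‖a‖ ^ 4) hf.aestronglyMeasurable]
          exact hfi
      _ = _ := by simp
  have hM := mul_meas_ge_le_integral_of_nonneg (Filter.Eventually.of_forall fun b =>
    Finset.sum_nonneg fun j _ => by positivity) hi (R * m)
  rw [le_div_iff₀ hR]
  have hsub : (Measure.pi fun _ : Fin m => complexGaussian n).real
      {b | R * m < ∑ j, (1 + ‖b j‖ ^ 4)} ≤ (Measure.pi fun _ : Fin m => complexGaussian n).real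
      {b | R * m ≤ ∑ j, (1 + ‖b j‖ ^ 4)} := measureReal_mono fun b hb => le_of_lt (Set.mem_ofPred_eq ▸ hb)
  have := hM.trans hint
  have h3 : (m : ℝ) * (R * (Measure.pi fun _ : Fin m => complexGaussian n).real
      {b | R * m < ∑ j, (1 + ‖b j‖ ^ 4)}) ≤ m * (17 * (n : ℝ) ^ 2) := by
    refine le_trans ?_ this
    calc _ = R * m * (Measure.pi fun _ : Fin m => complexGaussian n).real
          {b | R * m < ∑ j, (1 + ‖b j‖ ^ 4)} := by ring
      _ ≤ _ := by gcongr
  have := le_of_mul_le_mul_left h3 hm'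
  linarith

/-- A family of functions of a measurement, indexed by the unit ball and Lipschitz in the index
with a constant growing polynomially, satisfies a Chernoff bound uniformly over the sphere as soon
as the sample size exceeds a multiple of `n log n`. -/
theorem exists_uniform_sum_le {q s L η τ : ℝ} (hq : 0 < q) (hq1 : q < 1) (hs : 0 ≤ s) (hL : 0 < L)
    (hη : 0 < η) (hτ : 0 < τ) :
    ∃ C > 0, ∀ n m : ℕ, 2 ≤ n → C * (n * Real.log n) ≤ m →
      ∀ g : CVec n → RVec n → ℝ, (∀ v, Measurable fun a => g a v) →
        (∀ v, 1 / 2 ≤ ‖v‖ → ‖v‖ ≤ 1 → ExpMomentLE (complexGaussian n) s q fun a => g a v) →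
        (∀ a v w, ‖v‖ ≤ 1 → ‖w‖ ≤ 1 → |g a v - g a w| ≤ L * (1 + ‖a‖ ^ 4) * ‖v - w‖) →
        ∃ S : Set (Fin m → CVec n), MeasurableSet S ∧
          (Measure.pi fun _ : Fin m => complexGaussian n).real Sᶜ ≤ τ / (n : ℝ) ^ 2 ∧
          ∀ b ∈ S, ∀ v, ‖v‖ = 1 → ∑ j, g (b j) v ≤ η * m := by
  have hA : 0 < 34 * L / (τ * η) := by positivity
  -- With mesh parameter `N ≥ A n⁵`, the first term keeps the discretization error below `η m`, and
  -- the `2` keeps the distance to the grid below `1/2`.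
  set A := 34 * L / (τ * η) + 2 with hAdef
  obtain ⟨C, hC, H⟩ := exists_sample_size_grid (B := 2 * A + 3) (τ := τ / 2) (by linarith) hq hq1
    (by positivity)
  refine ⟨C, hC, fun n m hn hm g hgm hgexp hglip => ?_⟩
  have hn' : (2 : ℝ) ≤ n := by exact_mod_cast hn
  have hn0 : (0 : ℝ) < n := by linarith
  set N := ⌈A * (n : ℝ) ^ 5⌉₊
  have hNle : A * (n : ℝ) ^ 5 ≤ N := Nat.le_ceil _
  have hNlt : (N : ℝ) < A * (n : ℝ) ^ 5 + 1 := Nat.ceil_lt_add_one (by positivity)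
  have hN0 : (0 : ℝ) < N := lt_of_lt_of_le (by positivity) hNle
  obtain ⟨G, hGcard, hG⟩ := exists_grid n N (by exact_mod_cast hN0)
  set P := Measure.pi fun _ : Fin m => complexGaussian n
  -- Chosen so that Markov's bound `17 n² / R` equals `τ / (2 n²)`.
  set R := 34 * (n : ℝ) ^ 4 / τ with hRdef
  have hR : 0 < R := by positivity
  classical
  -- Only grid points of norm at least `1/2` can be close to the sphere, so exponential moments are
  -- needed only there.
  set G' := G.filter fun w => 1 / 2 ≤ ‖w‖ ∧ ‖w‖ ≤ 1
  have hmeas : ∀ w, Measurable fun b : Fin m → CVec n => ∑ j, g (b j) w := fun w =>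
    Finset.measurable_fun_sum _ fun j _ => (hgm w).comp (measurable_pi_apply j)
  set U := (⋃ w ∈ G', {b : Fin m → CVec n | 0 ≤ ∑ j, g (b j) w}) ∪
    {b | R * m < ∑ j, (1 + ‖b j‖ ^ 4)}
  have hU : MeasurableSet U := by
    refine MeasurableSet.union ?_ (measurableSet_lt measurable_const (by fun_prop))
    exact Finset.measurableSet_biUnion _ fun w _ => measurableSet_le measurable_const (hmeas w)
  refine ⟨Uᶜ, hU.compl, ?_, fun b hb v hv => ?_⟩
  · rw [compl_compl]
    have e1 : P.real (⋃ w ∈ G', {b : Fin m → CVec n | 0 ≤ ∑ j, g (b j) w}) ≤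
        τ / 2 / (n : ℝ) ^ 2 := by
      refine (measureReal_biUnion_finset_le _ _).trans ?_
      calc ∑ w ∈ G', P.real {b : Fin m → CVec n | 0 ≤ ∑ j, g (b j) w}
          ≤ ∑ w ∈ G', q ^ m := Finset.sum_le_sum fun w hw => by
            have hw' := (Finset.mem_filter.1 hw).2
            exact (hgexp w hw'.1 hw'.2).pi_sum_nonneg_le hs m
        _ = (G'.card : ℝ) * q ^ m := by simp
        _ ≤ ((2 * A + 3) * (n : ℝ) ^ 5) ^ n * q ^ m := by
            gcongr
            calc (G'.card : ℝ) ≤ (2 * N + 1) ^ n := by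
                  exact_mod_cast (Finset.card_filter_le _ _).trans hGcard
              _ ≤ _ := by
                gcongr
                have : (1 : ℝ) ≤ (n : ℝ) ^ 5 := one_le_pow₀ (by linarith)
                nlinarith
        _ ≤ _ := H n m hn hm
    have e2 := pi_sum_norm_pow_four_le (n := n) (m := m) (by omega) hR
    refine (measureReal_union_le _ _).trans ((add_le_add e1 e2).trans_eq ?_)
    rw [hRdef]
    field_simp
    norm_num
  · rw [Set.mem_compl_iff, Set.mem_union, not_or] at hb
    obtain ⟨hb1, hb2⟩ := hb
    obtain ⟨w, hwG, hw1, hw2⟩ := hG v hv.le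
    have hnN : (n : ℝ) / N ≤ 1 / 2 := by
      rw [div_le_iff₀ hN0]
      have h1 : (n : ℝ) ≤ (n : ℝ) ^ 5 := le_self_pow₀ (by linarith) (by norm_num)
      nlinarith
    have hw3 : 1 / 2 ≤ ‖w‖ := by
      have := norm_sub_norm_le v w
      linarith
    have hw4 : ‖w‖ ≤ 1 := hw1.trans hv.le
    have hneg : ∑ j, g (b j) w < 0 := by
      by_contra hcon
      exact hb1 (Set.mem_iUnion₂.2 ⟨w, Finset.mem_filter.2 ⟨hwG, hw3, hw4⟩, not_lt.1 hcon⟩)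
    have htr : ∑ j, (1 + ‖b j‖ ^ 4) ≤ R * m := not_lt.1 hb2
    have hdiff : ∑ j, (g (b j) v - g (b j) w) ≤ L * (R * m) * (n / N) := by
      calc ∑ j, (g (b j) v - g (b j) w) ≤ ∑ j, L * (1 + ‖b j‖ ^ 4) * (n / N) :=
            Finset.sum_le_sum fun j _ => (le_abs_self _).trans
              ((hglip _ _ _ hv.le hw4).trans (by gcongr))
        _ = L * (∑ j, (1 + ‖b j‖ ^ 4)) * (n / N) := by rw [Finset.mul_sum, Finset.sum_mul]
        _ ≤ _ := by gcongr
    rw [Finset.sum_sub_distrib] at hdiff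
    have hfin : L * R * (n / N) ≤ η := by
      rw [mul_div_assoc', div_le_iff₀ hN0]
      calc L * R * n = η * (34 * L / (τ * η) * (n : ℝ) ^ 5) := by
            rw [hRdef]; field_simp
        _ ≤ η * (A * (n : ℝ) ^ 5) := by gcongr; linarith
        _ ≤ η * N := by gcongr
    have : L * (R * m) * (n / N) ≤ η * m := by
      calc L * (R * m) * (n / N) = L * R * (n / N) * m := by ring
        _ ≤ _ := by gcongr
    linarith

/-! ### Concentration of the fourth moment -/

/-- The minimum is at most `Y`, so it has exponential moments, and at most `Y² / M`, so the first-
and second-order terms are of order `1 / M`. At `s = 1/4` they total at most `772 / M`, and the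
centring `3092 / 4 = 773` leaves `-1 / M`. -/
theorem expMomentLE_truncated_energy_sq {n : ℕ} (h : RVec n) (hh : ‖h‖ ≤ 1) {M : ℝ} (hM : 1 ≤ M) :
    ExpMomentLE (complexGaussian n) (1 / 4) (Real.exp (-1 / M))
      (fun a => min (energy a h ^ 2 / M) (energy a h) - 3092 / M) := by
  have hM0 : 0 < M := by linarith
  obtain ⟨hE1, hE2⟩ := integrable_exp_half_energy_and_le h hh
  obtain ⟨hS1, hS2⟩ := integrable_energy_pow_and_le h hh 2
  norm_num [Nat.factorial] at hS2
  have hpt : ∀ a : CVec n, Real.exp (1 / 4 * min (energy a h ^ 2 / M) (energy a h)) ≤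
      1 + 1 / (4 * M) * energy a h ^ 2 + 384 / M ^ 2 * Real.exp (energy a h / 2) := fun a => by
    set Y := energy a h
    have hY : 0 ≤ Y := energy_nonneg a h
    set X := min (Y ^ 2 / M) Y
    have hX0 : 0 ≤ X := le_min (by positivity) hY
    have hX1 : X ≤ Y ^ 2 / M := min_le_left _ _
    have hX2 : X ≤ Y := min_le_right _ _
    refine (exp_le_one_add_add_sq_mul _).trans ?_
    rw [abs_of_nonneg (by positivity)]
    have h1 : 1 / 4 * X ≤ 1 / (4 * M) * Y ^ 2 := by
      calc 1 / 4 * X ≤ 1 / 4 * (Y ^ 2 / M) := by gcongr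
        _ = _ := by field_simp
    have h3 : Y ^ 4 ≤ 6144 * Real.exp (Y / 4) := by
      have := pow_le_factorial_mul_exp_half (y := Y / 2) (by positivity) 4
      norm_num [Nat.factorial] at this
      have h4 : Y / 2 / 2 = Y / 4 := by ring
      rw [h4, div_pow] at this
      linarith
    have h5 : Real.exp (Y / 2) = Real.exp (Y / 4) * Real.exp (Y / 4) := by
      rw [← Real.exp_add]; ring_nf
    have h6 : (1 / 4 * X) ^ 2 * Real.exp (1 / 4 * X) ≤
        384 / M ^ 2 * Real.exp (Y / 4) * Real.exp (Y / 4) := by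
      have h7 : (1 / 4 * X) ^ 2 ≤ 384 / M ^ 2 * Real.exp (Y / 4) := by
        calc (1 / 4 * X) ^ 2 ≤ (1 / (4 * M) * Y ^ 2) ^ 2 := by gcongr
          _ = 1 / (16 * M ^ 2) * Y ^ 4 := by field_simp; ring
          _ ≤ 1 / (16 * M ^ 2) * (6144 * Real.exp (Y / 4)) := by gcongr
          _ = _ := by field_simp; ring
      have h8 : Real.exp (1 / 4 * X) ≤ Real.exp (Y / 4) := Real.exp_le_exp.2 (by linarith)
      exact mul_le_mul h7 h8 (Real.exp_pos _).le (by positivity)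
    rw [h5]
    linarith
  have hint : Integrable (fun a => 1 + 1 / (4 * M) * energy a h ^ 2 +
      384 / M ^ 2 * Real.exp (energy a h / 2)) (complexGaussian n) :=
    ((integrable_const _).add (hS1.const_mul _)).add (hE1.const_mul _)
  have hi : Integrable (fun a => Real.exp (1 / 4 * min (energy a h ^ 2 / M) (energy a h)))
      (complexGaussian n) :=
    hint.mono' (Measurable.aestronglyMeasurable (by fun_prop))
      (Filter.Eventually.of_forall fun a => by
        rw [Real.norm_of_nonneg (Real.exp_pos _).le]; exact hpt a)
  have heq : ∀ a : CVec n, Real.exp (1 / 4 * (min (energy a h ^ 2 / M) (energy a h) - 3092 / M)) =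
      Real.exp (-773 / M) * Real.exp (1 / 4 * min (energy a h ^ 2 / M) (energy a h)) :=
    fun a => by rw [← Real.exp_add]; ring_nf
  have hle : ∫ a, Real.exp (1 / 4 * min (energy a h ^ 2 / M) (energy a h)) ∂(complexGaussian n) ≤
      Real.exp (772 / M) := by
    refine (integral_mono hi hint hpt).trans ?_
    rw [((hasMean_const.add (HasMean.const_mul (1 / (4 * M)) ⟨hS1, rfl⟩)).add
      (HasMean.const_mul (384 / M ^ 2) ⟨hE1, rfl⟩)).2]
    have h1 : 1 / (4 * M) * ∫ a, energy a h ^ 2 ∂(complexGaussian n) ≤ 4 / M := by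
      calc _ ≤ 1 / (4 * M) * 16 := by gcongr
        _ = _ := by field_simp; norm_num
    have h2 : 384 / M ^ 2 * ∫ a, Real.exp (energy a h / 2) ∂(complexGaussian n) ≤ 768 / M := by
      calc _ ≤ 384 / M ^ 2 * 2 := by gcongr
        _ = 768 / M / M := by field_simp; norm_num
        _ ≤ 768 / M := div_le_self (by positivity) hM
    have h3 := Real.add_one_le_exp (772 / M)
    have h4 : 4 / M + 768 / M = 772 / M := by rw [← add_div]; norm_num
    linarith
  unfold ExpMomentLE
  simp_rw [heq]
  refine ⟨hi.const_mul _, ?_⟩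
  rw [integral_const_mul]
  calc _ ≤ Real.exp (-773 / M) * Real.exp (772 / M) := by gcongr
    _ = _ := by rw [← Real.exp_add, ← add_div]; norm_num

/-- Markov's inequality for the sixth power: with `M = √m`, a union over `m` samples then costs a
multiple of `m⁻²`. -/
theorem measureReal_le_energy_le {n : ℕ} (h : RVec n) (hh : ‖h‖ ≤ 1) {M : ℝ} (hM : 0 < M) :
    (complexGaussian n).real {a | M ≤ energy a h} ≤ 92160 / M ^ 6 := by
  obtain ⟨h1, h2⟩ := integrable_energy_pow_and_le h hh 6
  norm_num [Nat.factorial] at h2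
  have hM6 := mul_meas_ge_le_integral_of_nonneg (Filter.Eventually.of_forall fun a =>
    pow_nonneg (energy_nonneg a h) 6) h1 (M ^ 6)
  rw [le_div_iff₀ (by positivity), mul_comm]
  refine le_trans ?_ (hM6.trans h2)
  exact mul_le_mul_of_nonneg_left
    (measureReal_mono fun a ha => pow_le_pow_left₀ hM.le ha 6) (by positivity)

/-- The squared energy has no exponential moments, so it is truncated at level `M = √m`. Some energy
exceeds `M` with probability of order `m · M⁻⁶ = m⁻²`; otherwise the truncated sum obeys a Chernoff
bound `exp (-√m)`, at most `24 / m²`. -/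
theorem pi_sum_energy_sq_le {n m : ℕ} (h : RVec n) (hh : ‖h‖ ≤ 1) (hm : 0 < m) :
    (Measure.pi fun _ : Fin m => complexGaussian n).real
      {b | 3092 * m < ∑ j, energy (b j) h ^ 2} ≤ 92184 / (m : ℝ) ^ 2 := by
  have hm' : (1 : ℝ) ≤ m := by exact_mod_cast hm
  set M := √(m : ℝ)
  have hM : 1 ≤ M := Real.one_le_sqrt.2 hm'
  have hM0 : 0 < M := by linarith
  have hMm : M ^ 2 = m := Real.sq_sqrt (by linarith)
  set P := Measure.pi fun _ : Fin m => complexGaussian n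
  have hsub : {b : Fin m → CVec n | 3092 * m < ∑ j, energy (b j) h ^ 2} ⊆
      (⋃ j ∈ Finset.univ, {b | M ≤ energy (b j) h}) ∪
      {b | 0 ≤ ∑ j, (min (energy (b j) h ^ 2 / M) (energy (b j) h) - 3092 / M)} := by
    intro b (hb : 3092 * m < ∑ j, energy (b j) h ^ 2)
    by_cases hj : ∃ j, M ≤ energy (b j) h
    · obtain ⟨j, hj⟩ := hj
      exact Or.inl (Set.mem_iUnion₂.2 ⟨j, Finset.mem_univ j, hj⟩)
    · push Not at hj
      refine Or.inr ?_
      change 0 ≤ ∑ j, (min (energy (b j) h ^ 2 / M) (energy (b j) h) - 3092 / M)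
      have h1 : ∀ j, min (energy (b j) h ^ 2 / M) (energy (b j) h) = energy (b j) h ^ 2 / M :=
        fun j => min_eq_left (by
          rw [div_le_iff₀ hM0, pow_two]
          exact mul_le_mul_of_nonneg_left (hj j).le (energy_nonneg _ _))
      simp_rw [h1, ← sub_div, ← Finset.sum_div, Finset.sum_sub_distrib]
      apply div_nonneg _ hM0.le
      simp only [Finset.sum_const, Finset.card_univ, Fintype.card_fin, nsmul_eq_mul]
      linarith
  have e1 : P.real (⋃ j ∈ Finset.univ, {b | M ≤ energy (b j) h}) ≤ 92160 / (m : ℝ) ^ 2 := by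
    refine (measureReal_biUnion_finset_le _ _).trans ?_
    calc ∑ j : Fin m, P.real {b | M ≤ energy (b j) h} ≤ ∑ _j : Fin m, 92160 / M ^ 6 :=
          Finset.sum_le_sum fun j _ => by
            have hp := (measurePreserving_eval (fun _ : Fin m => complexGaussian n)
              j).measureReal_preimage (s := {a | M ≤ energy a h})
              (measurableSet_le measurable_const (by fun_prop)).nullMeasurableSet
            exact hp.trans_le (measureReal_le_energy_le h hh hM0)
      _ = 92160 / (m : ℝ) ^ 2 := by
          have : M ^ 6 = (m : ℝ) ^ 3 := by rw [← hMm]; ring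
          rw [this]
          simp only [Finset.sum_const, Finset.card_univ, Fintype.card_fin, nsmul_eq_mul]
          field_simp
  have e2 : P.real {b | 0 ≤ ∑ j, (min (energy (b j) h ^ 2 / M) (energy (b j) h) - 3092 / M)} ≤
      24 / (m : ℝ) ^ 2 := by
    refine ((expMomentLE_truncated_energy_sq h hh hM).pi_sum_nonneg_le (by norm_num) m).trans ?_
    rw [← Real.exp_nat_mul]
    have h1 : (m : ℝ) * (-1 / M) = -M := by rw [← hMm]; field_simp
    have h2 := Real.pow_div_factorial_le_exp M hM0.le 4
    norm_num [Nat.factorial] at h2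
    have h3 : M ^ 4 = (m : ℝ) ^ 2 := by rw [← hMm]; ring
    rw [h3] at h2
    rw [h1, Real.exp_neg, inv_le_comm₀ (Real.exp_pos _) (by positivity), inv_div]
    exact h2
  refine (measureReal_mono hsub).trans ((measureReal_union_le _ _).trans ?_)
  refine (add_le_add e1 e2).trans_eq ?_
  rw [← add_div]; norm_num

theorem exists_sample_size_energy_sq {τ : ℝ} (hτ : 0 < τ) :
    ∃ C > 0, ∀ n m : ℕ, 2 ≤ n → C * (n * Real.log n) ≤ m → ∀ h : RVec n, ‖h‖ ≤ 1 →
      (Measure.pi fun _ : Fin m => complexGaussian n).real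
        {b | 3092 * m < ∑ j, energy (b j) h ^ 2} ≤ τ / (n : ℝ) ^ 2 := by
  have h2 : 0 < Real.log 2 := Real.log_pos one_lt_two
  refine ⟨√(92184 / τ) / Real.log 2, by positivity, fun n m hn hm h hh => ?_⟩
  have hn' : (2 : ℝ) ≤ n := by exact_mod_cast hn
  have hln : Real.log 2 ≤ Real.log n := Real.log_le_log two_pos hn'
  have hm1 : √(92184 / τ) * n ≤ m := by
    refine le_trans ?_ hm
    calc √(92184 / τ) * n = √(92184 / τ) / Real.log 2 * (n * Real.log 2) := by field_simp
      _ ≤ _ := by gcongr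
  have hm0 : (0 : ℝ) < m := lt_of_lt_of_le (by positivity) hm1
  refine (pi_sum_energy_sq_le h hh (by exact_mod_cast hm0)).trans ?_
  rw [div_le_div_iff₀ (by positivity) (by positivity)]
  calc 92184 * (n : ℝ) ^ 2 = τ * (√(92184 / τ) * n) ^ 2 := by
        rw [mul_pow, Real.sq_sqrt (by positivity)]; field_simp
    _ ≤ τ * (m : ℝ) ^ 2 := by gcongr

/-! ### One Gauss–Newton step -/

theorem observation_eq_energy {n : ℕ} (z : RVec n) (a : CVec n) :
    observation z a = energy a z := by
  have h : inner ℂ a (toComplex z) =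
      (inner ℝ (rePart a) z : ℝ) - (inner ℝ (imPart a) z : ℝ) * Complex.I := by
    apply Complex.ext <;>
    simp [toComplex, rePart, imPart, PiLp.inner_apply]
  rw [observation, h, Complex.sq_norm, Complex.normSq_apply, energy]
  simp
  ring

theorem jacobian_mulVec {m n : ℕ} (a : Fin m → CVec n) (x v : RVec n) (j : Fin m) :
    (jacobian a x).mulVec v.ofLp j = 2 / √(m : ℝ) * corr (a j) x v := by
  have h : ∀ u : RVec n, (inner ℝ u v : ℝ) = ∑ i, u i * v i := fun u => by
    simp [PiLp.inner_apply, mul_comm]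
  simp only [jacobian, Matrix.mulVec, dotProduct, Matrix.of_apply, corr, h (rePart (a j)),
    h (imPart (a j)), Finset.mul_sum, ← Finset.sum_add_distrib]
  exact Finset.sum_congr rfl fun i _ => by ring

theorem energy_sub_energy {n : ℕ} (a : CVec n) (x z : RVec n) :
    energy a x - energy a z = 2 * corr a x (x - z) - energy a (x - z) := by
  simp only [energy, corr, inner_sub_right]
  ring

/-- The observations are quadratic in the signal, so expanding at `x` leaves only the pure
second-order term, with no further remainder. -/
theorem residual_eq {m n : ℕ} (a : Fin m → CVec n) (x z : RVec n) :
    residual a (fun j => observation z (a j)) x =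
      (jacobian a x).mulVec (x - z).ofLp - fun j => 1 / √(m : ℝ) * energy (a j) (x - z) := by
  ext j
  rw [Pi.sub_apply, jacobian_mulVec]
  simp only [residual, observation_eq_energy]
  have := energy_sub_energy (a j) x z
  rw [show (inner ℝ (rePart (a j)) x : ℝ) ^ 2 + inner ℝ (imPart (a j)) x ^ 2 = energy (a j) x
    from rfl, this]
  ring

theorem gram_mulVec {m n : ℕ} (a : Fin m → CVec n) (x : RVec n) (v : Fin n → ℝ) :
    (gram a x).mulVec v = (jacobian a x).transpose.mulVec ((jacobian a x).mulVec v) := by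
  rw [gram, Matrix.mulVec_mulVec]

theorem dotProduct_transpose_mulVec {m n : ℕ} (J : Matrix (Fin m) (Fin n) ℝ) (v : Fin n → ℝ)
    (q : Fin m → ℝ) : v ⬝ᵥ J.transpose.mulVec q = J.mulVec v ⬝ᵥ q := by
  rw [Matrix.dotProduct_mulVec, Matrix.vecMul_transpose]

theorem isUnit_gram {m n : ℕ} (hm : 0 < m) {a : Fin m → CVec n} {x : RVec n} {κ : ℝ} (hκ : 0 < κ)
    (hlow : ∀ v : RVec n, κ * ‖v‖ ^ 2 * m ≤ ∑ j, corr (a j) x v ^ 2) : IsUnit (gram a x) := by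
  have hm' : (0 : ℝ) < m := by exact_mod_cast hm
  rw [← Matrix.mulVec_injective_iff_isUnit, ← Matrix.coe_mulVecLin, injective_iff_map_eq_zero]
  intro v hv
  rw [Matrix.mulVecLin_apply, gram_mulVec] at hv
  have h0 : v ⬝ᵥ (jacobian a x).transpose.mulVec ((jacobian a x).mulVec v) = 0 := by
    rw [hv, dotProduct_zero]
  rw [dotProduct_transpose_mulVec, dotProduct_self_eq_zero] at h0
  have h1 : ∀ j, corr (a j) x (WithLp.toLp 2 v) = 0 := fun j => by
    have h2 := congrFun h0 j
    rw [← WithLp.ofLp_toLp 2 v, jacobian_mulVec, Pi.zero_apply] at h2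
    exact (mul_eq_zero.1 h2).resolve_left (by positivity)
  have h3 := hlow (WithLp.toLp 2 v)
  simp only [h1] at h3
  have h4 : ‖(WithLp.toLp 2 v : RVec n)‖ ^ 2 ≤ 0 := by
    by_contra hc
    push Not at hc
    have : 0 < κ * ‖(WithLp.toLp 2 v : RVec n)‖ ^ 2 * m := by positivity
    simp at h3
    linarith
  have h5 : (WithLp.toLp 2 v : RVec n) = 0 := by
    rw [← norm_eq_zero]
    exact pow_eq_zero_iff two_ne_zero |>.1 (le_antisymm h4 (sq_nonneg _))
  simpa using congrArg WithLp.ofLp h5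

/-- The linear part of the residual cancels the old error, leaving the normal equations `JᵀJ w =
Jᵀq` for the new error `w`. Hence `J w` is a projection of `q`, and the lower bound on `J` converts
`‖J w‖ ≤ ‖q‖` into a bound on `‖w‖`. -/
theorem norm_gaussNewtonStep_sub_sq_le {m n : ℕ} (hm : 0 < m) {a : Fin m → CVec n} {x z : RVec n}
    {κ K : ℝ} (hκ : 0 < κ)
    (hlow : ∀ v : RVec n, κ * ‖v‖ ^ 2 * m ≤ ∑ j, corr (a j) x v ^ 2)
    (hup : ∑ j, energy (a j) (x - z) ^ 2 ≤ K * m) :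
    4 * κ * ‖gaussNewtonStep a (fun j => observation z (a j)) x - z‖ ^ 2 ≤ K := by
  have hm' : (0 : ℝ) < m := by exact_mod_cast hm
  have hu := isUnit_gram hm hκ hlow
  have hdet := (Matrix.isUnit_iff_isUnit_det _).1 hu
  set J := jacobian a x
  set q : Fin m → ℝ := fun j => 1 / √(m : ℝ) * energy (a j) (x - z)
  set w := gaussNewtonStep a (fun j => observation z (a j)) x - z
  have hw : w.ofLp = (x - z).ofLp -
      (gram a x)⁻¹.mulVec (J.transpose.mulVec (J.mulVec (x - z).ofLp - q)) := by
    simp only [w, gaussNewtonStep, residual_eq]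
    rw [WithLp.ofLp_sub, WithLp.ofLp_sub, WithLp.ofLp_sub]
    abel
  have hg : (gram a x).mulVec w.ofLp = J.transpose.mulVec q := by
    rw [hw, Matrix.mulVec_sub, Matrix.mulVec_mulVec, Matrix.mul_nonsing_inv _ hdet,
      Matrix.one_mulVec, Matrix.mulVec_sub, gram_mulVec]
    abel
  have hdot : J.mulVec w.ofLp ⬝ᵥ J.mulVec w.ofLp = J.mulVec w.ofLp ⬝ᵥ q := by
    rw [← dotProduct_transpose_mulVec, ← gram_mulVec, hg, dotProduct_transpose_mulVec]
  have hle : J.mulVec w.ofLp ⬝ᵥ J.mulVec w.ofLp ≤ q ⬝ᵥ q := by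
    have h1 : 0 ≤ (J.mulVec w.ofLp - q) ⬝ᵥ (J.mulVec w.ofLp - q) :=
      Finset.sum_nonneg fun i _ => mul_self_nonneg _
    rw [sub_dotProduct, dotProduct_sub, dotProduct_sub, dotProduct_comm q, ← hdot] at h1
    linarith
  have hsq : √(m : ℝ) ^ 2 = m := Real.sq_sqrt hm'.le
  have hJ : J.mulVec w.ofLp ⬝ᵥ J.mulVec w.ofLp = 4 / m * ∑ j, corr (a j) x w ^ 2 := by
    rw [dotProduct, Finset.mul_sum]
    refine Finset.sum_congr rfl fun j _ => ?_
    rw [jacobian_mulVec]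
    calc _ = 4 / √(m : ℝ) ^ 2 * corr (a j) x w ^ 2 := by ring
      _ = _ := by rw [hsq]
  have hq : q ⬝ᵥ q = 1 / m * ∑ j, energy (a j) (x - z) ^ 2 := by
    rw [dotProduct, Finset.mul_sum]
    refine Finset.sum_congr rfl fun j _ => ?_
    calc _ = 1 / √(m : ℝ) ^ 2 * energy (a j) (x - z) ^ 2 := by ring
      _ = _ := by rw [hsq]
  rw [hJ, hq] at hle
  calc 4 * κ * ‖w‖ ^ 2 = 4 / m * (κ * ‖w‖ ^ 2 * m) := by field_simp
    _ ≤ 4 / m * ∑ j, corr (a j) x w ^ 2 := by gcongr; exact hlow w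
    _ ≤ 1 / m * ∑ j, energy (a j) (x - z) ^ 2 := hle
    _ ≤ 1 / m * (K * m) := by gcongr
    _ = K := by field_simp

theorem jacobian_neg {m n : ℕ} (a : Fin m → CVec n) (x : RVec n) :
    jacobian a (-x) = -jacobian a x := by
  ext j i
  simp only [jacobian, Matrix.of_apply, Matrix.neg_apply, inner_neg_right]
  ring

theorem gram_neg {m n : ℕ} (a : Fin m → CVec n) (x : RVec n) : gram a (-x) = gram a x := by
  rw [gram, gram, jacobian_neg, Matrix.transpose_neg, Matrix.neg_mul,
    Matrix.mul_neg, neg_neg]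

/-- The Jacobian is odd and the residual even. This reduces the analysis to initial guesses on the
same side as `z`. -/
theorem gaussNewtonStep_neg {m n : ℕ} (a : Fin m → CVec n) (y : Fin m → ℝ) (x : RVec n) :
    gaussNewtonStep a y (-x) = -gaussNewtonStep a y x := by
  have hr : residual a y (-x) = residual a y x := by
    ext j; simp [residual]
  rw [gaussNewtonStep, gaussNewtonStep, gram_neg, jacobian_neg, hr, Matrix.transpose_neg,
    Matrix.neg_mulVec, Matrix.mulVec_neg, WithLp.toLp_neg]
  abel

/-! ### The initial guess -/

/-- The coefficients of the matrix of the initialization. -/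
noncomputable def initWeight {m : ℕ} (y : Fin m → ℝ) (j : Fin m) : ℝ :=
  1 / 2 - Real.exp (-(y j) / meanScale y ^ 2)

theorem initMap_apply {m n : ℕ} (a : Fin m → CVec n) (y : Fin m → ℝ) (v : RVec n) :
    initMap a y v = (1 / m : ℝ) • ∑ j, initWeight y j •
      ((inner ℝ (rePart (a j)) v : ℝ) • rePart (a j) +
        (inner ℝ (imPart (a j)) v : ℝ) • imPart (a j)) := by
  have hentry : ∀ i k, ((initMatrix a y).map Complex.re) i k =
      (1 / m : ℝ) * ∑ j, initWeight y j *
        (rePart (a j) i * rePart (a j) k + imPart (a j) i * imPart (a j) k) := fun i k => by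
    have h1 : (1 / m : ℂ) = ((1 / m : ℝ) : ℂ) := by push_cast; rfl
    rw [Matrix.map_apply, initMatrix, Matrix.smul_apply, smul_eq_mul, h1, Complex.re_ofReal_mul,
      Matrix.sum_apply, Complex.re_sum]
    congr 1
    refine Finset.sum_congr rfl fun j _ => ?_
    rw [Matrix.smul_apply, smul_eq_mul, Complex.re_ofReal_mul, Matrix.vecMulVec_apply]
    simp [initWeight, rePart, imPart]
  have hin : ∀ u : RVec n, (inner ℝ u v : ℝ) = ∑ i, u i * v i := fun u => by
    simp [PiLp.inner_apply, mul_comm]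
  ext i
  rw [initMap, Matrix.toEuclideanLin, Matrix.ofLp_toLpLin, Matrix.toLin'_apply, Matrix.mulVec,
    dotProduct]
  simp_rw [hentry, hin]
  simp only [PiLp.smul_apply, WithLp.ofLp_sum, Finset.sum_apply, PiLp.add_apply, smul_eq_mul,
    Finset.mul_sum, Finset.sum_mul]
  rw [Finset.sum_comm]
  refine Finset.sum_congr rfl fun j _ => ?_
  rw [← Finset.sum_add_distrib, Finset.mul_sum, Finset.mul_sum]
  exact Finset.sum_congr rfl fun k _ => by ring

theorem inner_initMap {m n : ℕ} (a : Fin m → CVec n) (y : Fin m → ℝ) (v w : RVec n) :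
    inner ℝ (initMap a y v) w = (1 / m : ℝ) * ∑ j, initWeight y j * corr (a j) v w := by
  rw [initMap_apply, real_inner_smul_left, sum_inner]
  simp only [real_inner_smul_left, inner_add_left, corr]

theorem inner_initMap_self {m n : ℕ} (a : Fin m → CVec n) (y : Fin m → ℝ) (v : RVec n) :
    inner ℝ (initMap a y v) v = (1 / m : ℝ) * ∑ j, initWeight y j * energy (a j) v := by
  rw [inner_initMap]
  simp only [corr, energy, pow_two]

theorem isSymmetric_initMap {m n : ℕ} (a : Fin m → CVec n) (y : Fin m → ℝ) :
    (initMap a y).IsSymmetric := fun v w => by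
  rw [inner_initMap, real_inner_comm, inner_initMap]
  simp only [corr]
  congr 1
  exact Finset.sum_congr rfl fun j _ => by ring

/-- Allows `λ²` to be replaced by `1` in the weights. The bound is uniform in `y` because `t exp
(-t) ≤ 1`. -/
theorem abs_exp_neg_div_sub_le {y μ η : ℝ} (hy : 0 ≤ y) (hη : η ≤ 1 / 2) (hμ : |μ - 1| ≤ η) :
    |Real.exp (-y / μ) - Real.exp (-y)| ≤ 2 * η := by
  obtain ⟨h1, h2⟩ := abs_le.1 hμ
  have hμ0 : 0 < μ := by linarith
  have key : ∀ t d : ℝ, 0 ≤ t → 0 ≤ d → Real.exp (-t) - Real.exp (-(t + t * d)) ≤ d := by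
    intro t d ht hd
    have h3 : Real.exp (-(t + t * d)) = Real.exp (-t) * Real.exp (-(t * d)) := by
      rw [← Real.exp_add]; ring_nf
    have h4 := Real.add_one_le_exp (-(t * d))
    have h5 : Real.exp (-t) * t ≤ 1 := by
      have := Real.add_one_le_exp t
      rw [Real.exp_neg, inv_mul_le_iff₀ (Real.exp_pos t)]; linarith
    rw [h3]
    calc Real.exp (-t) - Real.exp (-t) * Real.exp (-(t * d))
        ≤ Real.exp (-t) - Real.exp (-t) * (1 - t * d) := by
          gcongr; linarith
      _ = Real.exp (-t) * t * d := by ring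
      _ ≤ 1 * d := by gcongr
      _ = d := one_mul d
  rcases le_total μ 1 with h | h
  · have hd : 0 ≤ 1 / μ - 1 := by rw [sub_nonneg, le_div_iff₀ hμ0]; linarith
    have h3 := key y (1 / μ - 1) hy hd
    have h4 : -(y + y * (1 / μ - 1)) = -y / μ := by field_simp; ring
    have h5 : 1 / μ - 1 ≤ 2 * η := by
      rw [sub_le_iff_le_add, div_le_iff₀ hμ0]; nlinarith
    rw [h4] at h3
    have h6 : Real.exp (-y / μ) ≤ Real.exp (-y) := by
      rw [← h4]; exact Real.exp_le_exp.2 (by nlinarith [mul_nonneg hy hd])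
    rw [abs_sub_comm, abs_of_nonneg (by linarith)]
    linarith
  · have h3 := key (y / μ) (μ - 1) (by positivity) (by linarith)
    have h4 : -(y / μ + y / μ * (μ - 1)) = -y := by field_simp; ring
    rw [h4] at h3
    have h6 : Real.exp (-y) ≤ Real.exp (-(y / μ)) :=
      Real.exp_le_exp.2 (by rw [neg_le_neg_iff]; exact div_le_self hy h)
    rw [neg_div, abs_of_nonneg (by linarith)]
    linarith

/-- The concentration properties of a block used by the initialization. -/
structure InitRegular {m n : ℕ} (η : ℝ) (z : RVec n) (a : Fin m → CVec n) : Prop where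
  mean_le : ∑ j, energy (a j) z ≤ (1 + η) * m
  le_mean : (1 - η) * m ≤ ∑ j, energy (a j) z
  energy_le : ∀ v : RVec n, ‖v‖ = 1 → ∑ j, energy (a j) v ≤ 3 * m
  weighted_le : ∀ v : RVec n, ‖v‖ = 1 →
    ∑ j, (1 / 2 - Real.exp (-energy (a j) z)) * energy (a j) v ≤
      ((inner ℝ v z : ℝ) ^ 2 / 4 + η) * m
  le_weighted : (1 / 4 - η) * m ≤ ∑ j, (1 / 2 - Real.exp (-energy (a j) z)) * energy (a j) z

namespace InitRegular

variable {m n : ℕ} {η : ℝ} {z : RVec n} {a : Fin m → CVec n}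

theorem abs_meanScale_sq_sub_one_le (h : InitRegular η z a) (hm : 0 < m) :
    |meanScale (fun j => observation z (a j)) ^ 2 - 1| ≤ η := by
  have hm' : (0 : ℝ) < m := by exact_mod_cast hm
  have h1 := h.mean_le
  have h2 := h.le_mean
  have h0 : 0 ≤ ∑ j, energy (a j) z := Finset.sum_nonneg fun j _ => energy_nonneg _ _
  simp only [meanScale, observation_eq_energy]
  rw [Real.sq_sqrt (by positivity), abs_le]
  constructor
  · rw [one_div_mul_eq_div, neg_le_sub_iff_le_add, ← sub_le_iff_le_add, le_div_iff₀ hm']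
    exact h2
  · rw [one_div_mul_eq_div, sub_le_iff_le_add, div_le_iff₀ hm']
    linarith

theorem abs_meanScale_sub_one_le (h : InitRegular η z a) (hm : 0 < m) :
    |meanScale (fun j => observation z (a j)) - 1| ≤ η := by
  have h1 := h.abs_meanScale_sq_sub_one_le hm
  set l := meanScale (fun j => observation z (a j))
  have hl : 0 ≤ l := Real.sqrt_nonneg _
  have h2 : l ^ 2 - 1 = (l - 1) * (l + 1) := by ring
  rw [h2, abs_mul, abs_of_nonneg (by linarith : 0 ≤ l + 1)] at h1
  nlinarith [abs_nonneg (l - 1)]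

/-- Replacing `λ²` by `1` changes each weight by at most `2 η`, and the total energy in a unit
direction is at most `3 m`. -/
theorem abs_inner_initMap_sub_le (h : InitRegular η z a) (hm : 0 < m) (hη : η ≤ 1 / 2)
    (v : RVec n) (hv : ‖v‖ = 1) :
    |inner ℝ (initMap a (fun j => observation z (a j)) v) v -
      (1 / m : ℝ) * ∑ j, (1 / 2 - Real.exp (-energy (a j) z)) * energy (a j) v| ≤ 6 * η := by
  have hm' : (0 : ℝ) < m := by exact_mod_cast hm
  have hμ := h.abs_meanScale_sq_sub_one_le hm
  have hη0 : 0 ≤ η := (abs_nonneg _).trans hμ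
  rw [inner_initMap_self, ← mul_sub, ← Finset.sum_sub_distrib, abs_mul,
    abs_of_pos (by positivity : (0 : ℝ) < 1 / m)]
  calc _ ≤ (1 / m : ℝ) * ∑ j, 2 * η * energy (a j) v := by
        gcongr
        refine (Finset.abs_sum_le_sum_abs _ _).trans (Finset.sum_le_sum fun j _ => ?_)
        rw [← sub_mul, abs_mul, abs_of_nonneg (energy_nonneg _ _)]
        gcongr
        · exact energy_nonneg _ _
        have := abs_exp_neg_div_sub_le (energy_nonneg (a j) z) hη hμ
        rw [initWeight, observation_eq_energy, sub_sub_sub_cancel_left, abs_sub_comm]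
        exact this
    _ ≤ (1 / m : ℝ) * (2 * η * (3 * m)) := by
        rw [← Finset.mul_sum]
        gcongr
        exact h.energy_le v hv
    _ = 6 * η := by field_simp; ring

theorem inner_initMap_le (h : InitRegular η z a) (hm : 0 < m) (hη : η ≤ 1 / 2) (v : RVec n) :
    inner ℝ (initMap a (fun j => observation z (a j)) v) v ≤
      (inner ℝ v z : ℝ) ^ 2 / 4 + 7 * η * ‖v‖ ^ 2 := by
  have hm' : (0 : ℝ) < m := by exact_mod_cast hm
  have hunit : ∀ w : RVec n, ‖w‖ = 1 →
      inner ℝ (initMap a (fun j => observation z (a j)) w) w ≤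
        (inner ℝ w z : ℝ) ^ 2 / 4 + 7 * η := fun w hw => by
    have h1 := (abs_le.1 (h.abs_inner_initMap_sub_le hm hη w hw)).2
    have h2 := h.weighted_le w hw
    have h3 : (1 / m : ℝ) * ∑ j, (1 / 2 - Real.exp (-energy (a j) z)) * energy (a j) w ≤
        (inner ℝ w z : ℝ) ^ 2 / 4 + η := by
      rw [one_div_mul_eq_div, div_le_iff₀ hm']; exact h2
    linarith
  rcases eq_or_ne v 0 with rfl | hv
  · simp
  have hv0 : 0 < ‖v‖ := norm_pos_iff.2 hv
  obtain ⟨w, hw, hvw⟩ : ∃ w : RVec n, ‖w‖ = 1 ∧ v = ‖v‖ • w :=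
    ⟨‖v‖⁻¹ • v, by rw [norm_smul, norm_inv, norm_norm, inv_mul_cancel₀ hv0.ne'],
      by rw [smul_inv_smul₀ hv0.ne']⟩
  have h1 := mul_le_mul_of_nonneg_left (hunit w hw) (sq_nonneg ‖v‖)
  rw [hvw, map_smul, real_inner_smul_left, real_inner_smul_left, real_inner_smul_right, ← hvw]
  linarith

theorem le_inner_initMap (h : InitRegular η z a) (hm : 0 < m) (hη : η ≤ 1 / 2) (hz : ‖z‖ = 1) :
    1 / 4 - 7 * η ≤ inner ℝ (initMap a (fun j => observation z (a j)) z) z := by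
  have hm' : (0 : ℝ) < m := by exact_mod_cast hm
  have h1 := (abs_le.1 (h.abs_inner_initMap_sub_le hm hη z hz)).1
  have h3 : 1 / 4 - η ≤
      (1 / m : ℝ) * ∑ j, (1 / 2 - Real.exp (-energy (a j) z)) * energy (a j) z := by
    rw [one_div_mul_eq_div, le_div_iff₀ hm']; exact h.le_weighted
  linarith

end InitRegular

/-- The supremum of the Rayleigh quotient is itself an eigenvalue, hence at most `t`. -/
theorem inner_le_of_isGreatest_eigenvalue {n : ℕ} [Nontrivial (RVec n)] {T : Module.End ℝ (RVec n)}
    (hT : T.IsSymmetric) {t : ℝ} (ht : IsGreatest {s : ℝ | T.HasEigenvalue s} t) (v : RVec n) :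
    inner ℝ (T v) v ≤ t * ‖v‖ ^ 2 := by
  have h1 : (⨆ x : { x : RVec n // x ≠ 0 }, RCLike.re (inner ℝ (T x) x) / ‖(x : RVec n)‖ ^ 2) ≤ t :=
    ht.2 hT.hasEigenvalue_iSup_of_finiteDimensional
  rcases eq_or_ne v 0 with rfl | hv
  · simp
  have hbdd : BddAbove (Set.range fun x : { x : RVec n // x ≠ 0 } =>
      RCLike.re (inner ℝ (T x) x) / ‖(x : RVec n)‖ ^ 2) := by
    refine ⟨‖LinearMap.toContinuousLinearMap T‖, ?_⟩
    rintro _ ⟨x, rfl⟩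
    have hx : 0 < ‖(x : RVec n)‖ := norm_pos_iff.2 x.2
    change inner ℝ (T x) (x : RVec n) / ‖(x : RVec n)‖ ^ 2 ≤ _
    rw [div_le_iff₀ (by positivity)]
    calc inner ℝ (T x) (x : RVec n) ≤ ‖T x‖ * ‖(x : RVec n)‖ := real_inner_le_norm _ _
      _ ≤ ‖LinearMap.toContinuousLinearMap T‖ * ‖(x : RVec n)‖ * ‖(x : RVec n)‖ := by
        gcongr
        exact (LinearMap.toContinuousLinearMap T).le_opNorm x
      _ = _ := by ring
  have h2 := (le_ciSup hbdd ⟨v, hv⟩).trans h1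
  have hv0 : 0 < ‖v‖ := norm_pos_iff.2 hv
  rw [div_le_iff₀ (by positivity)] at h2
  exact h2

theorem exists_isGreatest_eigenvalue {n : ℕ} [Nontrivial (RVec n)] {T : Module.End ℝ (RVec n)}
    (hT : T.IsSymmetric) : ∃ t, IsGreatest {s : ℝ | T.HasEigenvalue s} t :=
  (Module.End.finite_hasEigenvalue T).isCompact.exists_isGreatest
    ⟨_, hT.hasEigenvalue_iSup_of_finiteDimensional⟩

theorem nontrivial_of_norm_eq_one {n : ℕ} {z : RVec n} (hz : ‖z‖ = 1) : Nontrivial (RVec n) :=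
  ⟨z, 0, fun h => by simp [h] at hz⟩

/-- The relation satisfied, up to sign, by every initial guess, and by at most one vector. -/
def IsNormalizedGuess {m n : ℕ} (z : RVec n) (a : Fin m → CVec n) (x : RVec n) : Prop :=
  ‖x‖ = meanScale (fun j => observation z (a j)) ∧ 0 ≤ (inner ℝ x z : ℝ) ∧
    ‖x‖ ^ 2 • initMap a (fun j => observation z (a j)) x =
      (inner ℝ (initMap a (fun j => observation z (a j)) x) x : ℝ) • x ∧
    3 / 16 * ‖x‖ ^ 2 ≤ inner ℝ (initMap a (fun j => observation z (a j)) x) x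

namespace InitRegular

variable {m n : ℕ} {η : ℝ} {z : RVec n} {a : Fin m → CVec n}

theorem meanScale_pos (h : InitRegular η z a) (hm : 0 < m) (hη : η ≤ 1 / 2) :
    0 < meanScale (fun j => observation z (a j)) := by
  have := (abs_le.1 (h.abs_meanScale_sub_one_le hm)).1
  linarith

theorem exists_isInitialGuess (h : InitRegular η z a) (hm : 0 < m) (hη : η ≤ 1 / 2)
    (hz : ‖z‖ = 1) : ∃ x, IsInitialGuess a (fun j => observation z (a j)) x := by
  have := nontrivial_of_norm_eq_one hz
  obtain ⟨t, ht⟩ := exists_isGreatest_eigenvalue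
    (isSymmetric_initMap a (fun j => observation z (a j)))
  obtain ⟨v, hv⟩ := ht.1.exists_hasEigenvector
  have hv0 : 0 < ‖v‖ := norm_pos_iff.2 hv.2
  have hl := h.meanScale_pos hm hη
  set l := meanScale (fun j => observation z (a j))
  refine ⟨(l / ‖v‖) • v, ?_, t, ht, ?_⟩
  · rw [norm_smul, Real.norm_of_nonneg (by positivity), div_mul_cancel₀ _ hv0.ne']
  · exact ⟨Submodule.smul_mem _ _ hv.1, smul_ne_zero (by positivity) hv.2⟩

theorem le_inner_of_isInitialGuess (h : InitRegular η z a) (hm : 0 < m) (hη : η ≤ 1 / 2)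
    (hz : ‖z‖ = 1) {x : RVec n} (hx : IsInitialGuess a (fun j => observation z (a j)) x) :
    (1 / 4 - 7 * η) * ‖x‖ ^ 2 ≤ inner ℝ (initMap a (fun j => observation z (a j)) x) x := by
  have := nontrivial_of_norm_eq_one hz
  obtain ⟨-, t, ht, hx⟩ := hx
  have h1 := inner_le_of_isGreatest_eigenvalue
    (isSymmetric_initMap a (fun j => observation z (a j))) ht z
  rw [hz, one_pow, mul_one] at h1
  rw [hx.apply_eq_smul, real_inner_smul_left, real_inner_self_eq_norm_sq]
  gcongr
  exact (h.le_inner_initMap hm hη hz).trans h1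

theorem isNormalizedGuess (h : InitRegular η z a) (hm : 0 < m) (hη : η ≤ 1 / 256)
    (hz : ‖z‖ = 1) {x : RVec n} (hx : IsInitialGuess a (fun j => observation z (a j)) x)
    (hxz : 0 ≤ (inner ℝ x z : ℝ)) : IsNormalizedGuess z a x := by
  refine ⟨hx.1, hxz, ?_, ?_⟩
  · obtain ⟨-, t, ht, hx⟩ := hx
    rw [hx.apply_eq_smul, real_inner_smul_left, real_inner_self_eq_norm_sq, smul_smul, mul_comm]
  · refine le_trans ?_ (h.le_inner_of_isInitialGuess hm (by linarith) hz hx)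
    gcongr
    linarith

/-- The Rayleigh quotient of `x` is at least that of `z`, about `1/4`, while it is at most about
`⟨x, z⟩² / (4 ‖x‖²)`. So `x` is nearly parallel to `z`, and its norm `λ` is nearly `1`. -/
theorem norm_sub_sq_le (h : InitRegular η z a) (hm : 0 < m) (hη : η ≤ 1 / 256)
    (hz : ‖z‖ = 1) {x : RVec n} (hx : IsInitialGuess a (fun j => observation z (a j)) x)
    (hxz : 0 ≤ (inner ℝ x z : ℝ)) : ‖x - z‖ ^ 2 ≤ 128 * η := by
  have h1 := h.le_inner_of_isInitialGuess hm (by linarith) hz hx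
  have h2 := h.inner_initMap_le hm (by linarith) x
  have h3 := h.abs_meanScale_sub_one_le hm
  have hη0 : 0 ≤ η := (abs_nonneg _).trans h3
  rw [← hx.1] at h3
  set l := ‖x‖
  have hl := abs_le.1 h3
  have h4 : (1 - 56 * η) * l ^ 2 ≤ (inner ℝ x z : ℝ) ^ 2 := by linarith
  have h5 : (1 - 56 * η) * l ≤ inner ℝ x z := by
    have : ((1 - 56 * η) * l) ^ 2 ≤ (inner ℝ x z : ℝ) ^ 2 := by
      refine le_trans ?_ h4
      rw [mul_pow]
      gcongr
      nlinarith
    exact le_of_sq_le_sq this hxz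
  rw [norm_sub_sq_real, hz]
  change l ^ 2 - 2 * inner ℝ x z + 1 ^ 2 ≤ 128 * η
  nlinarith

/-- Two non-parallel solutions would span a plane with Rayleigh quotient at least `3/16`. That plane
meets the orthogonal complement of `z`, where the quotient is at most `7 η < 3/16`. Equal norms and
the sign condition then fix the vector. -/
theorem isNormalizedGuess_unique (h : InitRegular η z a) (hm : 0 < m) (hη : η ≤ 1 / 256)
    {x x' : RVec n} (hx : IsNormalizedGuess z a x) (hx' : IsNormalizedGuess z a x') : x = x' := by
  have hl := h.meanScale_pos hm (by linarith)
  have hη0 : 0 ≤ η := (abs_nonneg _).trans (h.abs_meanScale_sub_one_le hm)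
  have hS := isSymmetric_initMap a (fun j => observation z (a j))
  have hupper := h.inner_initMap_le hm (by linarith)
  obtain ⟨hn, hp, he, hr⟩ := hx
  obtain ⟨hn', hp', he', hr'⟩ := hx'
  set T := initMap a (fun j => observation z (a j))
  set l := meanScale (fun j => observation z (a j))
  have eig : ∀ w : RVec n, ‖w‖ = l → ‖w‖ ^ 2 • T w = (inner ℝ (T w) w : ℝ) • w →
      3 / 16 * ‖w‖ ^ 2 ≤ inner ℝ (T w) w → ∃ t : ℝ, 3 / 16 ≤ t ∧ T w = t • w := by
    intro w hw h1 h2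
    refine ⟨inner ℝ (T w) w / l ^ 2, ?_, ?_⟩
    · rw [le_div_iff₀ (by positivity), ← hw]; exact h2
    · rw [div_eq_inv_mul, mul_smul, ← h1, hw, inv_smul_smul₀ (by positivity)]
  obtain ⟨t, ht, hT⟩ := eig x hn he hr
  obtain ⟨t', ht', hT'⟩ := eig x' hn' he' hr'
  have pos : ∀ w : RVec n, ‖w‖ = l → 0 ≤ (inner ℝ w z : ℝ) →
      3 / 16 * ‖w‖ ^ 2 ≤ inner ℝ (T w) w → 0 < (inner ℝ w z : ℝ) := by
    intro w hw h1 h2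
    refine lt_of_le_of_ne h1 fun h0 => ?_
    have h3 := hupper w
    rw [← h0, hw] at h3
    rw [hw] at h2
    nlinarith [pow_pos hl 2]
  have hp := pos x hn hp hr
  have hp' := pos x' hn' hp' hr'
  have hcross : t * (inner ℝ x x' : ℝ) = t' * inner ℝ x x' := by
    have := hS x x'
    rwa [hT, hT', real_inner_smul_left, real_inner_smul_right] at this
  -- The combination `α x - β x'` is the vector of the span orthogonal to `z`.
  set α : ℝ := inner ℝ x' z
  set β : ℝ := inner ℝ x z
  set w := α • x - β • x' with hw
  have hwz : (inner ℝ w z : ℝ) = 0 := by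
    rw [hw, inner_sub_left, real_inner_smul_left, real_inner_smul_left]; ring
  have hwn : ‖w‖ ^ 2 = α ^ 2 * l ^ 2 - 2 * α * β * inner ℝ x x' + β ^ 2 * l ^ 2 := by
    rw [hw, norm_sub_sq_real, norm_smul, norm_smul, real_inner_smul_left, real_inner_smul_right,
      hn, hn', mul_pow, mul_pow, Real.norm_eq_abs, Real.norm_eq_abs, sq_abs, sq_abs]
    ring
  have hTw : (inner ℝ (T w) w : ℝ) =
      α ^ 2 * (t * l ^ 2) - 2 * α * β * (t * inner ℝ x x') + β ^ 2 * (t' * l ^ 2) := by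
    have e1 : (inner ℝ x x : ℝ) = l ^ 2 := by rw [real_inner_self_eq_norm_sq, hn]
    have e2 : (inner ℝ x' x' : ℝ) = l ^ 2 := by rw [real_inner_self_eq_norm_sq, hn']
    have e3 : (inner ℝ x' x : ℝ) = inner ℝ x x' := real_inner_comm _ _
    simp only [hw, map_sub, map_smul, hT, hT', inner_sub_left, inner_sub_right,
      real_inner_smul_left, real_inner_smul_right, e1, e2, e3]
    linear_combination α * β * hcross
  have hlow : 3 / 16 * ‖w‖ ^ 2 ≤ inner ℝ (T w) w := by
    rw [hwn, hTw]
    rcases eq_or_ne t t' with rfl | hne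
    · have : 0 ≤ ‖w‖ ^ 2 := sq_nonneg _
      rw [hwn] at this
      nlinarith
    · have h0 : (inner ℝ x x' : ℝ) = 0 := by
        by_contra hc
        exact hne (mul_right_cancel₀ hc hcross)
      rw [h0]
      have e1 : 0 ≤ α ^ 2 * l ^ 2 := by positivity
      have e2 : 0 ≤ β ^ 2 * l ^ 2 := by positivity
      nlinarith
  have hw0 : w = 0 := by
    have h1 := hupper w
    rw [hwz] at h1
    have h2 : ‖w‖ ^ 2 ≤ 0 := by nlinarith [sq_nonneg ‖w‖]
    rw [← norm_eq_zero]
    exact pow_eq_zero_iff two_ne_zero |>.1 (le_antisymm h2 (sq_nonneg _))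
  have hαβ : α • x = β • x' := sub_eq_zero.1 hw0
  have hnorm := congrArg norm hαβ
  rw [norm_smul, norm_smul, hn, hn', Real.norm_of_nonneg hp'.le, Real.norm_of_nonneg hp.le] at hnorm
  rw [mul_right_cancel₀ hl.ne' hnorm] at hαβ
  exact smul_right_injective _ hp.ne' hαβ

end InitRegular

theorem IsInitialGuess.neg {m n : ℕ} {a : Fin m → CVec n} {y : Fin m → ℝ} {x : RVec n}
    (h : IsInitialGuess a y x) : IsInitialGuess a y (-x) := by
  obtain ⟨h1, t, ht, hx⟩ := h
  exact ⟨by rw [norm_neg, h1], t, ht, Submodule.neg_mem _ hx.1, neg_ne_zero.2 hx.2⟩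

/-! ### Lipschitz bounds in the direction -/

theorem energy_le {n : ℕ} (a : CVec n) (v : RVec n) : energy a v ≤ ‖a‖ ^ 2 * ‖v‖ ^ 2 := by
  have h : ‖a‖ ^ 2 = ‖rePart a‖ ^ 2 + ‖imPart a‖ ^ 2 := by
    simp only [EuclideanSpace.norm_sq_eq, ← Finset.sum_add_distrib]
    refine Finset.sum_congr rfl fun i _ => ?_
    rw [Complex.sq_norm, Complex.normSq_apply]
    simp [rePart, imPart, pow_two]
  rw [h, add_mul, energy, ← mul_pow, ← mul_pow]
  exact add_le_add (sq_le_sq.2 ((abs_real_inner_le_norm _ _).trans (le_abs_self _)))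
    (sq_le_sq.2 ((abs_real_inner_le_norm _ _).trans (le_abs_self _)))

theorem abs_corr_le {n : ℕ} (a : CVec n) (x v : RVec n) :
    |corr a x v| ≤ ‖a‖ ^ 2 * (‖x‖ * ‖v‖) := by
  apply abs_le_of_sq_le_sq _ (by positivity)
  calc corr a x v ^ 2 ≤ energy a x * energy a v := corr_sq_le a x v
    _ ≤ (‖a‖ ^ 2 * ‖x‖ ^ 2) * (‖a‖ ^ 2 * ‖v‖ ^ 2) :=
      mul_le_mul (energy_le a x) (energy_le a v) (energy_nonneg _ _) (by positivity)
    _ = _ := by ring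

theorem norm_add_le_two {n : ℕ} {v w : RVec n} (hv : ‖v‖ ≤ 1) (hw : ‖w‖ ≤ 1) : ‖v + w‖ ≤ 2 :=
  (norm_add_le _ _).trans (by linarith)

theorem abs_energy_sub_le {n : ℕ} (a : CVec n) {v w : RVec n} (hv : ‖v‖ ≤ 1) (hw : ‖w‖ ≤ 1) :
    |energy a v - energy a w| ≤ (1 + ‖a‖ ^ 4) * ‖v - w‖ := by
  have h : energy a v - energy a w = corr a (v - w) (v + w) := by
    simp only [energy, corr, inner_sub_right, inner_add_right]; ring
  rw [h]
  calc _ ≤ ‖a‖ ^ 2 * (‖v - w‖ * ‖v + w‖) := abs_corr_le _ _ _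
    _ ≤ ‖a‖ ^ 2 * (‖v - w‖ * 2) := by gcongr; exact norm_add_le_two hv hw
    _ = 2 * ‖a‖ ^ 2 * ‖v - w‖ := by ring
    _ ≤ _ := by
      gcongr
      nlinarith [sq_nonneg (‖a‖ ^ 2 - 1)]

theorem abs_corr_sq_sub_le {n : ℕ} (a : CVec n) {x v w : RVec n} (hx : ‖x‖ = 1) (hv : ‖v‖ ≤ 1)
    (hw : ‖w‖ ≤ 1) : |corr a x v ^ 2 - corr a x w ^ 2| ≤ 2 * (1 + ‖a‖ ^ 4) * ‖v - w‖ := by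
  have h : corr a x v ^ 2 - corr a x w ^ 2 = corr a x (v - w) * corr a x (v + w) := by
    simp only [corr, inner_sub_right, inner_add_right]; ring
  rw [h, abs_mul]
  calc _ ≤ (‖a‖ ^ 2 * (‖x‖ * ‖v - w‖)) * (‖a‖ ^ 2 * (‖x‖ * ‖v + w‖)) :=
        mul_le_mul (abs_corr_le _ _ _) (abs_corr_le _ _ _) (abs_nonneg _) (by positivity)
    _ ≤ (‖a‖ ^ 2 * (‖x‖ * ‖v - w‖)) * (‖a‖ ^ 2 * (‖x‖ * 2)) := by
        gcongr; exact norm_add_le_two hv hw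
    _ = 2 * ‖a‖ ^ 4 * ‖v - w‖ := by rw [hx]; ring
    _ ≤ _ := by gcongr; linarith

theorem abs_inner_sq_sub_le {n : ℕ} {z v w : RVec n} (hz : ‖z‖ = 1) (hv : ‖v‖ ≤ 1)
    (hw : ‖w‖ ≤ 1) : |(inner ℝ v z : ℝ) ^ 2 - (inner ℝ w z : ℝ) ^ 2| ≤ 2 * ‖v - w‖ := by
  have h : (inner ℝ v z : ℝ) ^ 2 - (inner ℝ w z : ℝ) ^ 2 =
      (inner ℝ (v - w) z : ℝ) * inner ℝ (v + w) z := by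
    simp only [inner_sub_left, inner_add_left]; ring
  rw [h, abs_mul]
  calc _ ≤ (‖v - w‖ * ‖z‖) * (‖v + w‖ * ‖z‖) :=
        mul_le_mul (abs_real_inner_le_norm _ _) (abs_real_inner_le_norm _ _) (abs_nonneg _)
          (by positivity)
    _ ≤ (‖v - w‖ * ‖z‖) * (2 * ‖z‖) := by gcongr; exact norm_add_le_two hv hw
    _ = _ := by rw [hz]; ring

theorem abs_initial_weight_le {y : ℝ} (hy : 0 ≤ y) : |1 / 2 - Real.exp (-y)| ≤ 1 := by
  have h1 := Real.exp_pos (-y)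
  have h2 : Real.exp (-y) ≤ 1 := Real.exp_le_one_iff.2 (by linarith)
  rw [abs_le]; constructor <;> linarith

/-! ### Regularity of a random block -/

theorem ExpMomentLE.mono {α : Type*} [MeasurableSpace α] {μ : Measure α} {s q q' : ℝ} {g : α → ℝ}
    (h : ExpMomentLE μ s q g) (hq : q ≤ q') : ExpMomentLE μ s q' g :=
  ⟨h.1, h.2.trans hq⟩

theorem expMomentLE_energy {n : ℕ} (v : RVec n) (hv : ‖v‖ ≤ 1) :
    ExpMomentLE (complexGaussian n) (1 / 2) 2 (fun a => energy a v) := by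
  obtain ⟨h1, h2⟩ := integrable_exp_half_energy_and_le v hv
  have : ∀ a : CVec n, Real.exp (1 / 2 * energy a v) = Real.exp (energy a v / 2) := fun a => by
    ring_nf
  unfold ExpMomentLE
  simp_rw [this]
  exact ⟨h1, h2⟩

/-- The exponential moment of a variable dominated by the energy, above its mean. -/
theorem expMomentLE_sub_of_abs_le_energy {n : ℕ} {v : RVec n} (hv : ‖v‖ ≤ 1) {X : CVec n → ℝ}
    {c η : ℝ} (hX : HasMean (complexGaussian n) X c) (hXv : ∀ a, |X a| ≤ energy a v)
    (hη : 0 < η) (hη' : η ≤ 1 / 2) :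
    ExpMomentLE (complexGaussian n) (η / 256) (Real.exp (-(η ^ 2 / 1024)))
      (fun a => X a - (c + η / 2)) := by
  -- The value `s = η / 256` minimizes `-s η / 2 + 64 s²`, with minimum `-η² / 1024`.
  refine (expMomentLE_of_abs_le (s := η / 256) (t := c + η / 2) hX hXv (expMomentLE_energy v hv)
    (by positivity) (by linarith)).mono ?_
  apply Real.exp_le_exp.2
  ring_nf
  nlinarith [sq_nonneg η]

theorem exists_initRegular {η τ : ℝ} (hη : 0 < η) (hη' : η ≤ 1 / 2) (hτ : 0 < τ) :
    ∃ C > 0, ∀ n m : ℕ, 2 ≤ n → C * (n * Real.log n) ≤ m → ∀ z : RVec n, ‖z‖ = 1 →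
      ∃ S : Set (Fin m → CVec n), MeasurableSet S ∧
        (Measure.pi fun _ : Fin m => complexGaussian n).real Sᶜ ≤ τ / (n : ℝ) ^ 2 ∧
        ∀ b ∈ S, InitRegular η z b := by
  have hq : Real.exp (-(η ^ 2 / 1024)) < 1 := Real.exp_lt_one_iff.2 (by
    rw [neg_lt_zero]; positivity)
  have he : 2 / Real.exp 1 < 1 := by
    rw [div_lt_one (Real.exp_pos 1)]
    linarith [Real.exp_one_gt_d9]
  obtain ⟨C₁, hC₁, H₁⟩ := exists_uniform_sum_le (s := η / 256) (L := 2) (η := η / 2) (τ := τ / 5)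
    (Real.exp_pos _) hq (by positivity) (by positivity) (by positivity) (by positivity)
  -- A crude bound suffices for the total energy: centring at `2` gives the exponential moment `2 /
  -- e < 1`, and the slack `1` makes the final constant `3`.
  obtain ⟨C₂, hC₂, H₂⟩ := exists_uniform_sum_le (s := 1 / 2) (L := 2) (η := 1) (τ := τ / 5)
    (by positivity) he (by positivity) (by positivity) (by positivity) (by positivity)
  refine ⟨max C₁ C₂, lt_max_of_lt_left hC₁, fun n m hn hm z hz => ?_⟩
  have hlog : 0 ≤ (n : ℝ) * Real.log n := by
    have : (1 : ℝ) ≤ n := by exact_mod_cast (by omega : 1 ≤ n)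
    have := Real.log_nonneg this
    positivity
  have hm₁ : C₁ * (n * Real.log n) ≤ m := le_trans (by gcongr; exact le_max_left _ _) hm
  have hm₂ : C₂ * (n * Real.log n) ≤ m := le_trans (by gcongr; exact le_max_right _ _) hm
  have hlip0 : ∀ (a : CVec n) (v w : RVec n), 0 ≤ 2 * (1 + ‖a‖ ^ 4) * ‖v - w‖ :=
    fun a v w => by positivity
  have hE := hasMean_energy z hz
  have hW := hasMean_weighted_energy z z hz
  have hWabs : ∀ (a : CVec n) (v : RVec n),
      |(1 / 2 - Real.exp (-energy a z)) * energy a v| ≤ energy a v := fun a v => by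
    rw [abs_mul, abs_of_nonneg (energy_nonneg a v)]
    exact mul_le_of_le_one_left (energy_nonneg _ _) (abs_initial_weight_le (energy_nonneg _ _))
  have hzz : (inner ℝ z z : ℝ) = 1 := by rw [real_inner_self_eq_norm_sq, hz, one_pow]
  -- Bounds at the single direction `z` use the same uniform lemma, with families constant in `v`.
  obtain ⟨S₁, hS₁, hp₁, h₁⟩ := H₁ n m hn hm₁ (fun a _ => energy a z - (1 + η / 2))
    (fun v => by fun_prop)
    (fun v _ _ => expMomentLE_sub_of_abs_le_energy hz.le hE
      (fun a => (abs_of_nonneg (energy_nonneg a z)).le) hη hη')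
    (fun a v w _ _ => by rw [sub_self, abs_zero]; exact hlip0 a v w)
  obtain ⟨S₂, hS₂, hp₂, h₂⟩ := H₁ n m hn hm₁ (fun a _ => -1 * energy a z - (-1 * 1 + η / 2))
    (fun v => by fun_prop)
    (fun v _ _ => expMomentLE_sub_of_abs_le_energy hz.le (hE.const_mul (-1))
      (fun a => by rw [neg_one_mul, abs_neg, abs_of_nonneg (energy_nonneg a z)]) hη hη')
    (fun a v w _ _ => by rw [sub_self, abs_zero]; exact hlip0 a v w)
  obtain ⟨S₃, hS₃, hp₃, h₃⟩ := H₂ n m hn hm₂ (fun a v => energy a v - 2)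
    (fun v => by fun_prop)
    (fun v _ hv => by
      have h := expMomentLE_energy v hv
      have heq : ∀ a : CVec n, Real.exp (1 / 2 * (energy a v - 2)) =
          (Real.exp 1)⁻¹ * Real.exp (1 / 2 * energy a v) := fun a => by
        rw [← Real.exp_neg, ← Real.exp_add]; ring_nf
      unfold ExpMomentLE
      simp_rw [heq]
      refine ⟨h.1.const_mul _, ?_⟩
      rw [integral_const_mul]
      exact (mul_le_mul_of_nonneg_left h.2 (by positivity)).trans_eq (div_eq_inv_mul _ _).symm)
    (fun a v w hv hw => by
      rw [sub_sub_sub_cancel_right]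
      refine (abs_energy_sub_le a hv hw).trans ?_
      have : 0 ≤ (1 + ‖a‖ ^ 4) * ‖v - w‖ := by positivity
      linarith)
  obtain ⟨S₄, hS₄, hp₄, h₄⟩ := H₁ n m hn hm₁
    (fun a v => (1 / 2 - Real.exp (-energy a z)) * energy a v - ((inner ℝ v z : ℝ) ^ 2 / 4 + η / 2))
    (fun v => by fun_prop)
    (fun v _ hv => expMomentLE_sub_of_abs_le_energy hv (hasMean_weighted_energy z v hz)
      (fun a => hWabs a v) hη hη')
    (fun a v w hv hw => by
      have e1 := abs_energy_sub_le a hv hw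
      have e2 := abs_inner_sq_sub_le hz hv hw
      have e3 := abs_initial_weight_le (energy_nonneg a z)
      have e4 : |(1 / 2 - Real.exp (-energy a z)) * (energy a v - energy a w)| ≤
          (1 + ‖a‖ ^ 4) * ‖v - w‖ := by
        rw [abs_mul]
        exact (mul_le_of_le_one_left (abs_nonneg _) e3).trans e1
      have e5 : ‖v - w‖ ≤ (1 + ‖a‖ ^ 4) * ‖v - w‖ :=
        le_mul_of_one_le_left (norm_nonneg _) (by linarith [pow_nonneg (norm_nonneg a) 4])
      rw [abs_le] at e2 e4 ⊢
      constructor <;> nlinarith [e2.1, e2.2, e4.1, e4.2])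
  obtain ⟨S₅, hS₅, hp₅, h₅⟩ := H₁ n m hn hm₁
    (fun a _ => -1 * ((1 / 2 - Real.exp (-energy a z)) * energy a z) -
      (-1 * ((inner ℝ z z : ℝ) ^ 2 / 4) + η / 2))
    (fun v => by fun_prop)
    (fun v _ _ => expMomentLE_sub_of_abs_le_energy hz.le (hW.const_mul (-1))
      (fun a => by rw [neg_one_mul, abs_neg]; exact hWabs a z) hη hη')
    (fun a v w _ _ => by rw [sub_self, abs_zero]; exact hlip0 a v w)
  refine ⟨S₁ ∩ (S₂ ∩ (S₃ ∩ (S₄ ∩ S₅))), hS₁.inter (hS₂.inter (hS₃.inter (hS₄.inter hS₅))), ?_, ?_⟩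
  · simp only [Set.compl_inter]
    refine (measureReal_union_le _ _).trans ?_
    have e5 := measureReal_union_le (μ := Measure.pi fun _ : Fin m => complexGaussian n) S₄ᶜ S₅ᶜ
    have e4 := measureReal_union_le (μ := Measure.pi fun _ : Fin m => complexGaussian n)
      S₃ᶜ (S₄ᶜ ∪ S₅ᶜ)
    have e3 := measureReal_union_le (μ := Measure.pi fun _ : Fin m => complexGaussian n)
      S₂ᶜ (S₃ᶜ ∪ (S₄ᶜ ∪ S₅ᶜ))
    have : τ / (n : ℝ) ^ 2 = 5 * (τ / 5 / (n : ℝ) ^ 2) := by ring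
    linarith
  · rintro b ⟨hb₁, hb₂, hb₃, hb₄, hb₅⟩
    have k₁ := h₁ b hb₁ z hz
    have k₂ := h₂ b hb₂ z hz
    have k₅ := h₅ b hb₅ z hz
    simp only [Finset.sum_sub_distrib, Finset.sum_const, Finset.card_univ, Fintype.card_fin,
      nsmul_eq_mul, ← Finset.mul_sum, hzz] at k₁ k₂ k₅
    refine ⟨by linarith, by linarith, fun v hv => ?_, fun v hv => ?_, by linarith⟩
    · have k₃ := h₃ b hb₃ v hv
      simp only [Finset.sum_sub_distrib, Finset.sum_const, Finset.card_univ, Fintype.card_fin,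
        nsmul_eq_mul] at k₃
      linarith
    · have k₄ := h₄ b hb₄ v hv
      simp only [Finset.sum_sub_distrib, Finset.sum_const, Finset.card_univ, Fintype.card_fin,
        nsmul_eq_mul] at k₄
      linarith

theorem exists_eq_norm_smul {n : ℕ} {x : RVec n} (hx : x ≠ 0) :
    ∃ w : RVec n, ‖w‖ = 1 ∧ x = ‖x‖ • w := by
  have hx0 : 0 < ‖x‖ := norm_pos_iff.2 hx
  exact ⟨‖x‖⁻¹ • x, by rw [norm_smul, norm_inv, norm_norm, inv_mul_cancel₀ hx0.ne'],
    by rw [smul_inv_smul₀ hx0.ne']⟩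

theorem exists_sample_size_corr {τ : ℝ} (hτ : 0 < τ) :
    ∃ C > 0, ∀ n m : ℕ, 2 ≤ n → C * (n * Real.log n) ≤ m → ∀ x : RVec n, 1 / 2 ≤ ‖x‖ →
      (Measure.pi fun _ : Fin m => complexGaussian n).real
        {b | ¬ ∀ v : RVec n, 1 / 128 * ‖v‖ ^ 2 * m ≤ ∑ j, corr (b j) x v ^ 2} ≤
          τ / (n : ℝ) ^ 2 := by
  -- For `‖v‖ ≥ 1/2` the mean is at least `1/8`, so with threshold `1/16` the exponent is at most
  -- `-s / 16 + 1536 s²`, minimized at `s = 1 / 49152`. The slack `1/32` leaves `1/32`, and `‖x‖² ≥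
  -- 1/4` turns it into `1/128`.
  obtain ⟨C, hC, H⟩ := exists_uniform_sum_le (q := Real.exp (-(1 / 1572864))) (s := 1 / 49152)
    (L := 2) (η := 1 / 32) (Real.exp_pos _) (Real.exp_lt_one_iff.2 (by norm_num)) (by positivity)
    (by positivity) (by positivity) hτ
  refine ⟨C, hC, fun n m hn hm x hx => ?_⟩
  obtain ⟨e, he, hxe⟩ := exists_eq_norm_smul (x := x) (norm_pos_iff.1 (by linarith))
  obtain ⟨S, -, hp, h⟩ := H n m hn hm (fun a v => 1 / 16 - corr a e v ^ 2)
    (fun v => by fun_prop)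
    (fun v hv hv' => by
      obtain ⟨c, hc, hmean⟩ := exists_hasMean_corr_sq e v he
      obtain ⟨h1, h2⟩ := integrable_corr_pow_four_and_le e v he.le hv'
      refine (expMomentLE_const_sub (s := 1 / 49152) (t := 1 / 16) hmean
        (fun a => sq_nonneg _) h1 h2 (by norm_num)).mono (Real.exp_le_exp.2 ?_)
      have : (1 / 2) ^ 2 ≤ ‖v‖ ^ 2 := by gcongr
      linarith)
    (fun a v w hv hw => by
      rw [sub_sub_sub_cancel_left, abs_sub_comm]
      exact abs_corr_sq_sub_le a he hv hw)
  refine le_trans (measureReal_mono fun b hb => ?_) hp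
  intro hbS
  refine hb fun v => ?_
  rcases eq_or_ne v 0 with rfl | hv
  · simp only [norm_zero]
    rw [zero_pow two_ne_zero, mul_zero, zero_mul]
    exact Finset.sum_nonneg fun j _ => sq_nonneg _
  obtain ⟨w, hw, hvw⟩ := exists_eq_norm_smul hv
  have k := h b hbS w hw
  simp only [Finset.sum_sub_distrib, Finset.sum_const, Finset.card_univ, Fintype.card_fin,
    nsmul_eq_mul] at k
  have hc : ∀ j, corr (b j) x v ^ 2 = ‖x‖ ^ 2 * ‖v‖ ^ 2 * corr (b j) e w ^ 2 := fun j => by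
    conv_lhs => rw [hxe, hvw]
    simp only [corr, real_inner_smul_right]
    ring
  simp_rw [hc]
  rw [← Finset.mul_sum]
  have hx2 : 1 / 4 ≤ ‖x‖ ^ 2 := by nlinarith
  calc 1 / 128 * ‖v‖ ^ 2 * m = 1 / 4 * ‖v‖ ^ 2 * (1 / 32 * m) := by ring
    _ ≤ ‖x‖ ^ 2 * ‖v‖ ^ 2 * ∑ j, corr (b j) e w ^ 2 := by
      gcongr
      linarith

/-- The conclusion of one step of the method: the normal matrix is nonsingular, and the error
decreases quadratically. -/
def StepRegular {n m : ℕ} (z x : RVec n) (b : Fin m → CVec n) : Prop :=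
  IsUnit (gram b x) ∧
    ‖gaussNewtonStep b (fun j => observation z (b j)) x - z‖ ≤ 315 * ‖x - z‖ ^ 2

/-- With `κ = 1/128` and the fourth-moment constant `3092`, the squared error constant is `32 · 3092
= 98944`, below `315² = 99225`. Only the direction of `x - z` is needed for the fourth moments. -/
theorem exists_sample_size_stepRegular {τ : ℝ} (hτ : 0 < τ) :
    ∃ C > 0, ∀ n m : ℕ, 2 ≤ n → C * (n * Real.log n) ≤ m → ∀ z x : RVec n, 1 / 2 ≤ ‖x‖ →
      (Measure.pi fun _ : Fin m => complexGaussian n).real {b | ¬ StepRegular z x b} ≤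
        τ / (n : ℝ) ^ 2 := by
  obtain ⟨C₁, hC₁, H₁⟩ := exists_sample_size_corr (τ := τ / 2) (by positivity)
  obtain ⟨C₂, hC₂, H₂⟩ := exists_sample_size_energy_sq (τ := τ / 2) (by positivity)
  refine ⟨max C₁ C₂, lt_max_of_lt_left hC₁, fun n m hn hm z x hx => ?_⟩
  have hn' : (1 : ℝ) < n := by exact_mod_cast (by omega : 1 < n)
  have hlog : 0 < (n : ℝ) * Real.log n := by
    have := Real.log_pos hn'
    positivity
  have hm₁ : C₁ * (n * Real.log n) ≤ m := le_trans (by gcongr; exact le_max_left _ _) hm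
  have hm₂ : C₂ * (n * Real.log n) ≤ m := le_trans (by gcongr; exact le_max_right _ _) hm
  have hm0 : (0 : ℝ) < m := lt_of_lt_of_le (by positivity) hm₁
  have hm0' : 0 < m := by exact_mod_cast hm0
  obtain ⟨e, he, hxe⟩ : ∃ e : RVec n, ‖e‖ ≤ 1 ∧ x - z = ‖x - z‖ • e := by
    rcases eq_or_ne (x - z) 0 with h | h
    · exact ⟨0, by simp, by rw [h]; simp⟩
    · obtain ⟨e, he, hxe⟩ := exists_eq_norm_smul h
      exact ⟨e, he.le, hxe⟩
  refine (measureReal_mono (s₂ := {b | ¬ ∀ v : RVec n, 1 / 128 * ‖v‖ ^ 2 * m ≤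
    ∑ j, corr (b j) x v ^ 2} ∪ {b | 3092 * m < ∑ j, energy (b j) e ^ 2}) ?_).trans ?_
  · intro b hb
    by_contra hcon
    rw [Set.mem_union, not_or] at hcon
    have hlow : ∀ v : RVec n, 1 / 128 * ‖v‖ ^ 2 * m ≤ ∑ j, corr (b j) x v ^ 2 :=
      not_not.1 hcon.1
    have hup : ∑ j, energy (b j) e ^ 2 ≤ 3092 * m := not_lt.1 hcon.2
    have hen : ∀ j, energy (b j) (x - z) ^ 2 = ‖x - z‖ ^ 4 * energy (b j) e ^ 2 := fun j => by
      conv_lhs => rw [hxe]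
      simp only [energy, real_inner_smul_right]
      ring
    have hup' : ∑ j, energy (b j) (x - z) ^ 2 ≤ 3092 * ‖x - z‖ ^ 4 * m := by
      simp_rw [hen]
      rw [← Finset.mul_sum]
      calc _ ≤ ‖x - z‖ ^ 4 * (3092 * m) := by gcongr
        _ = _ := by ring
    refine hb ⟨isUnit_gram hm0' (by norm_num) hlow, ?_⟩
    have key := norm_gaussNewtonStep_sub_sq_le hm0' (by norm_num) hlow hup'
    refine le_of_sq_le_sq ?_ (by positivity)
    have : (0 : ℝ) ≤ ‖x - z‖ ^ 4 := by positivity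
    calc _ ≤ 98944 * ‖x - z‖ ^ 4 := by linarith
      _ ≤ 99225 * ‖x - z‖ ^ 4 := by gcongr; norm_num
      _ = _ := by ring
  · refine (measureReal_union_le _ _).trans ((add_le_add (H₁ n m hn hm₁ x hx)
      (H₂ n m hn hm₂ e he)).trans_eq ?_)
    ring

/-! ### Measurability of the method -/

section MatrixMeasurability

variable {α ι : Type*} [MeasurableSpace α] [Fintype ι] [DecidableEq ι]

theorem measurable_det {M : α → Matrix ι ι ℝ} (hM : ∀ i j, Measurable fun a => M a i j) :
    Measurable fun a => (M a).det := by
  simp only [Matrix.det_apply']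
  fun_prop

/-- Cramer's formula holds for every matrix here, since the inverse of a singular matrix is `0` by
convention. -/
theorem measurable_inv_apply {M : α → Matrix ι ι ℝ} (hM : ∀ i j, Measurable fun a => M a i j)
    (i j : ι) : Measurable fun a => (M a)⁻¹ i j := by
  simp only [Matrix.inv_def, Matrix.smul_apply, smul_eq_mul, Ring.inverse_eq_inv',
    Matrix.adjugate_apply]
  refine (measurable_det hM).inv.mul (measurable_det fun k l => ?_)
  by_cases h : k = j
  · simp [h]
  · simp only [Matrix.updateRow_apply, h, if_false]; exact hM k l

end MatrixMeasurability

variable {m n : ℕ}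

theorem measurable_jacobian_apply (j : Fin m) (i : Fin n) :
    Measurable fun p : RVec n × (Fin m → CVec n) => jacobian p.2 p.1 j i := by
  simp only [jacobian, Matrix.of_apply]
  fun_prop

theorem measurable_gram_apply (i k : Fin n) :
    Measurable fun p : RVec n × (Fin m → CVec n) => gram p.2 p.1 i k := by
  simp only [gram, Matrix.mul_apply, Matrix.transpose_apply]
  exact Finset.measurable_fun_sum _ fun j _ =>
    (measurable_jacobian_apply j i).mul (measurable_jacobian_apply j k)

theorem measurable_gaussNewtonStep (z : RVec n) :
    Measurable fun p : RVec n × (Fin m → CVec n) =>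
      gaussNewtonStep p.2 (fun j => observation z (p.2 j)) p.1 := by
  have hr : ∀ j : Fin m, Measurable fun p : RVec n × (Fin m → CVec n) =>
      residual p.2 (fun j => observation z (p.2 j)) p.1 j := fun j => by
    simp only [residual, observation_eq_energy, energy]
    fun_prop
  unfold gaussNewtonStep
  refine measurable_fst.sub ((WithLp.measurable_toLp 2 _).comp (measurable_pi_iff.2 fun i => ?_))
  simp only [Matrix.mulVec, dotProduct, Matrix.transpose_apply]
  exact Finset.measurable_fun_sum _ fun k _ => (measurable_inv_apply measurable_gram_apply i k).mul
    (Finset.measurable_fun_sum _ fun j _ => (measurable_jacobian_apply j k).mul (hr j))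

theorem measurableSet_stepRegular (z : RVec n) :
    MeasurableSet {p : RVec n × (Fin m → CVec n) | StepRegular z p.1 p.2} := by
  have h := measurable_gaussNewtonStep (m := m) z
  have h1 : MeasurableSet {p : RVec n × (Fin m → CVec n) | IsUnit (gram p.2 p.1)} := by
    simp only [Matrix.isUnit_iff_isUnit_det, isUnit_iff_ne_zero]
    exact (measurableSet_eq_fun (measurable_det measurable_gram_apply) measurable_const).compl
  exact h1.inter (measurableSet_le (h.sub_const z).norm (by fun_prop))

theorem measurable_meanScale (z : RVec n) :
    Measurable fun b : Fin m → CVec n => meanScale (fun j => observation z (b j)) := by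
  simp only [meanScale, observation_eq_energy, energy]
  fun_prop

theorem measurable_initMap_apply (z : RVec n) :
    Measurable fun p : (Fin m → CVec n) × RVec n =>
      initMap p.1 (fun j => observation z (p.1 j)) p.2 := by
  have h := (measurable_meanScale (m := m) z).comp
    (measurable_fst : Measurable (Prod.fst : (Fin m → CVec n) × RVec n → _))
  have h : Measurable fun p : (Fin m → CVec n) × RVec n =>
      meanScale (fun j => observation z (p.1 j)) := h
  simp only [initMap_apply, initWeight, observation_eq_energy, energy] at h ⊢
  fun_prop

/-- The eigenvalue enters only as a Rayleigh quotient, so the relation is a conjunction of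
equalities and inequalities between measurable functions, with no quantifier over eigenvalues. -/
theorem measurableSet_isNormalizedGuess (z : RVec n) :
    MeasurableSet {p : (Fin m → CVec n) × RVec n | IsNormalizedGuess z p.1 p.2} := by
  have h1 := (measurable_meanScale (m := m) z).comp
    (measurable_fst : Measurable (Prod.fst : (Fin m → CVec n) × RVec n → _))
  have h2 := measurable_initMap_apply (m := m) z
  have h3 := h2.inner (𝕜 := ℝ) measurable_snd
  have e1 : MeasurableSet {p : (Fin m → CVec n) × RVec n |
      ‖p.2‖ = meanScale (fun j => observation z (p.1 j))} :=
    measurableSet_eq_fun (by fun_prop) h1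
  have e2 : MeasurableSet {p : (Fin m → CVec n) × RVec n | 0 ≤ (inner ℝ p.2 z : ℝ)} :=
    measurableSet_le measurable_const (by fun_prop)
  have e3 : MeasurableSet {p : (Fin m → CVec n) × RVec n |
      ‖p.2‖ ^ 2 • initMap p.1 (fun j => observation z (p.1 j)) p.2 =
        (inner ℝ (initMap p.1 (fun j => observation z (p.1 j)) p.2) p.2 : ℝ) • p.2} :=
    measurableSet_eq_fun ((measurable_snd.norm.pow_const 2).smul h2) (h3.smul measurable_snd)
  have e4 : MeasurableSet {p : (Fin m → CVec n) × RVec n | 3 / 16 * ‖p.2‖ ^ 2 ≤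
      inner ℝ (initMap p.1 (fun j => observation z (p.1 j)) p.2) p.2} :=
    measurableSet_le (by fun_prop) h3
  exact e1.inter (e2.inter (e3.inter e4))

/-- A Borel relation that determines its second argument is the graph of a measurable function on
its domain. -/
theorem exists_measurable_of_functional {X Y : Type*} [MeasurableSpace X] [StandardBorelSpace X]
    [MeasurableSpace Y] [StandardBorelSpace Y] [Nonempty Y] {Γ : Set (X × Y)}
    (hΓ : MeasurableSet Γ) (huniq : ∀ x y y', (x, y) ∈ Γ → (x, y') ∈ Γ → y = y') :
    ∃ f : X → Y, Measurable f ∧ ∀ x y, (x, y) ∈ Γ → f x = y := by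
  classical
  -- The first projection is injective on `Γ`, and an injective Borel image of a Borel set is Borel
  -- (Lusin–Souslin).
  have hproj : ∀ U : Set Y, MeasurableSet U → MeasurableSet (Prod.fst '' (Γ ∩ Prod.snd ⁻¹' U)) :=
    fun U hU => (hΓ.inter (measurable_snd hU)).image_of_measurable_injOn measurable_fst (by
      rintro ⟨x, y⟩ h ⟨x', y'⟩ h' (rfl : x = x')
      rw [huniq x y y' h.1 h'.1])
  let f : X → Y := fun x => if h : ∃ y, (x, y) ∈ Γ then h.choose else Classical.arbitrary Y
  have hf : ∀ x y, (x, y) ∈ Γ → f x = y := fun x y hxy => by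
    have h : ∃ y, (x, y) ∈ Γ := ⟨y, hxy⟩
    simp only [f, dif_pos h]
    exact huniq x _ _ h.choose_spec hxy
  refine ⟨f, fun U hU => ?_, hf⟩
  have hdom := hproj Set.univ MeasurableSet.univ
  have heq : f ⁻¹' U = Prod.fst '' (Γ ∩ Prod.snd ⁻¹' U) ∪
      ((Prod.fst '' (Γ ∩ Prod.snd ⁻¹' Set.univ))ᶜ ∩ {_x | Classical.arbitrary Y ∈ U}) := by
    ext x
    by_cases h : ∃ y, (x, y) ∈ Γ
    · obtain ⟨y, hy⟩ := h
      have hx : x ∈ Prod.fst '' (Γ ∩ Prod.snd ⁻¹' Set.univ) := ⟨(x, y), ⟨hy, trivial⟩, rfl⟩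
      rw [Set.mem_preimage, hf x y hy]
      constructor
      · exact fun hU => Or.inl ⟨(x, y), ⟨hy, hU⟩, rfl⟩
      · rintro (⟨⟨x', y'⟩, ⟨h1, h2⟩, rfl⟩ | ⟨h1, -⟩)
        · rwa [huniq _ _ _ hy h1]
        · exact absurd hx h1
    · have hx : x ∉ Prod.fst '' (Γ ∩ Prod.snd ⁻¹' Set.univ) := by
        rintro ⟨⟨x', y'⟩, ⟨h1, -⟩, rfl⟩
        exact h ⟨y', h1⟩
      have hx' : x ∉ Prod.fst '' (Γ ∩ Prod.snd ⁻¹' U) := by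
        rintro ⟨⟨x', y'⟩, ⟨h1, -⟩, rfl⟩
        exact h ⟨y', h1⟩
      have hfx : f x = Classical.arbitrary Y := by simp only [f, dif_neg h]
      rw [Set.mem_preimage, hfx]
      exact ⟨fun hU => Or.inr ⟨hx, hU⟩, fun hU => (hU.resolve_left hx').2⟩
  rw [heq]
  exact (hproj U hU).union (hdom.compl.inter (MeasurableSet.const _))

/-- A measurable choice of the initial guess with nonnegative correlation with the signal. -/
theorem exists_measurable_guess {η : ℝ} (hη : η ≤ 1 / 256) (hm : 0 < m) (z : RVec n)
    {S : Set (Fin m → CVec n)} (hS : MeasurableSet S) (hreg : ∀ b ∈ S, InitRegular η z b) :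
    ∃ f : (Fin m → CVec n) → RVec n, Measurable f ∧
      ∀ b ∈ S, ∀ x, IsNormalizedGuess z b x → f b = x := by
  obtain ⟨f, hf, h⟩ := exists_measurable_of_functional
    (Γ := (Prod.fst ⁻¹' S) ∩ {p : (Fin m → CVec n) × RVec n | IsNormalizedGuess z p.1 p.2})
    ((measurable_fst hS).inter (measurableSet_isNormalizedGuess z))
    (fun b x x' h h' => (hreg b h.1).isNormalizedGuess_unique hm hη h.2 h'.2)
  exact ⟨f, hf, fun b hb x hx => h b x ⟨hb, hx⟩⟩

/-! ### Iterations driven by independent blocks -/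

section Trajectory

variable {X B : Type*} {T : ℕ}

/-- The sequence started at `x` whose `k`-th term is computed with the entry `b k`. -/
def trajectory (step : X → B → X) (b : Fin (T + 1) → B) (x : X) : ℕ → X
  | 0 => x
  -- The index wraps modulo `T + 1`, which is harmless: only `k < T` is used.
  | k + 1 => step (trajectory step b x k) (b (Fin.ofNat (T + 1) (k + 1)))

theorem ofNat_succ_eq (k : Fin T) : Fin.ofNat (T + 1) (k + 1) = k.succ := by
  ext; simp [Fin.ofNat, Nat.mod_eq_of_lt]

theorem trajectory_succ (step : X → B → X) (b : Fin (T + 1) → B) (x : X) (k : Fin T) :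
    trajectory step b x (k + 1) = step (trajectory step b x k) (b k.succ) := by
  rw [trajectory, ofNat_succ_eq]

theorem trajectory_congr (step : X → B → X) {b b' : Fin (T + 1) → B} (x : X) {i : Fin (T + 1)}
    (h : ∀ j, j < i → b j = b' j) (k : ℕ) (hk : k < i) :
    trajectory step b x k = trajectory step b' x k := by
  induction k with
  | zero => rfl
  | succ k ih =>
    rw [trajectory, trajectory, ih (by omega), h]
    change (k + 1) % (T + 1) < (i : ℕ)
    rwa [Nat.mod_eq_of_lt (by omega)]

variable [MeasurableSpace X] [MeasurableSpace B]

theorem measurable_trajectory {step : X → B → X}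
    (hstep : Measurable fun p : X × B => step p.1 p.2) {f : B → X} (hf : Measurable f) (k : ℕ) :
    Measurable fun b : Fin (T + 1) → B => trajectory step b (f (b 0)) k := by
  induction k with
  | zero => exact hf.comp (measurable_pi_apply 0)
  | succ k ih => exact hstep.comp (ih.prodMk (measurable_pi_apply _))

/-- If each step is good with probability at least `1 - p` from every fixed point, all the steps
are good with probability at least `1 - T p`. -/
theorem exists_trajectory_good (ν : Measure B) [IsProbabilityMeasure ν] {step : X → B → X}
    (hstep : Measurable fun p : X × B => step p.1 p.2) {f : B → X} (hf : Measurable f)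
    {G : Set (X × B)} (hG : MeasurableSet G) {p : ℝ} (hp : ∀ x, ν.real {b | (x, b) ∉ G} ≤ p) :
    ∃ S : Set (Fin (T + 1) → B), MeasurableSet S ∧
      (Measure.pi fun _ : Fin (T + 1) => ν).real Sᶜ ≤ T * p ∧
      ∀ b ∈ S, ∀ k : Fin T, (trajectory step b (f (b 0)) k, b k.succ) ∈ G := by
  set P := Measure.pi fun _ : Fin (T + 1) => ν
  let bad : Fin T → Set (Fin (T + 1) → B) := fun k =>
    {b | (trajectory step b (f (b 0)) k, b k.succ) ∉ G}
  have hbad : ∀ k, MeasurableSet (bad k) := fun k =>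
    (((measurable_trajectory hstep hf k).prodMk (measurable_pi_apply k.succ)) hG).compl
  obtain ⟨a₀⟩ : Nonempty B := nonempty_of_isProbabilityMeasure ν
  have hp0 : 0 ≤ p := measureReal_nonneg.trans (hp (f a₀))
  have hbound : ∀ k, P.real (bad k) ≤ p := fun k => by
    set i := k.succ
    -- The iterate `x_k` does not involve block `k + 1`, so filling that slot with a dummy `a₀`
    -- writes it as a function of the other blocks. Integrating over block `k + 1` first then gives
    -- the bound at a fixed point.
    let F : (Fin T → B) → X := fun r =>
      trajectory step (i.insertNth (α := fun _ => B) a₀ r)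
        (f (i.insertNth (α := fun _ => B) a₀ r 0)) k
    have hF : Measurable F := by
      refine (measurable_trajectory hstep hf k).comp (?_ : Measurable fun r : Fin T → B =>
        (i.insertNth (α := fun _ => B) a₀ r))
      exact (MeasurableEquiv.piFinSuccAbove (fun _ => B) i).symm.measurable.comp
        (measurable_const.prodMk measurable_id)
    let D : Set (B × (Fin T → B)) := {q | (F q.2, q.1) ∉ G}
    have hD : MeasurableSet D := (((hF.comp measurable_snd).prodMk measurable_fst) hG).compl
    have hpre : bad k = MeasurableEquiv.piFinSuccAbove (fun _ => B) i ⁻¹' D := by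
      ext b
      have hne : ∀ j, j ≠ i →
          b j = i.insertNth (α := fun _ => B) a₀ (fun l => b (i.succAbove l)) j := fun j hj => by
        obtain ⟨l, rfl⟩ := Fin.exists_succAbove_eq hj
        rw [Fin.insertNth_apply_succAbove]
      have h0 : b 0 = i.insertNth (α := fun _ => B) a₀ (fun l => b (i.succAbove l)) 0 :=
        hne 0 (Fin.succ_ne_zero k).symm
      have ht := trajectory_congr step (f (b 0)) (i := i) (fun j hj => hne j hj.ne) k
        (by simp [i])
      change (trajectory step b (f (b 0)) k, b i) ∉ G ↔ (F (fun l => b (i.succAbove l)), b i) ∉ G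
      rw [ht]
      simp only [F]
      rw [← h0]
    have hmp := measurePreserving_piFinSuccAbove (fun _ : Fin (T + 1) => ν) i
    rw [hpre, hmp.measureReal_preimage hD.nullMeasurableSet, measureReal_def,
      Measure.prod_apply_symm hD]
    refine ENNReal.toReal_le_of_le_ofReal hp0 ?_
    calc _ ≤ ∫⁻ _r, ENNReal.ofReal p ∂(Measure.pi fun _ : Fin T => ν) := by
          refine lintegral_mono fun r => ?_
          rw [← ofReal_measureReal]
          exact ENNReal.ofReal_le_ofReal (hp (F r))
      _ = ENNReal.ofReal p := by simp
  refine ⟨(⋃ k ∈ Finset.univ, bad k)ᶜ,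
    (Finset.measurableSet_biUnion _ fun k _ => hbad k).compl, ?_, fun b hb k => ?_⟩
  · rw [compl_compl]
    refine (measureReal_biUnion_finset_le _ _).trans ?_
    calc _ ≤ ∑ _k : Fin T, p := Finset.sum_le_sum fun k _ => hbound k
      _ = T * p := by simp
  · by_contra hk
    exact hb (Set.mem_iUnion₂.2 ⟨k, Finset.mem_univ k, hk⟩)

end Trajectory

/-! ### The re-sampled method -/

theorem gaussNewtonStep_trajectory_neg {m n T : ℕ} (z : RVec n)
    (b : Fin (T + 1) → Fin m → CVec n) (x : RVec n) (k : ℕ) :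
    trajectory (fun x b => gaussNewtonStep b (fun j => observation z (b j)) x) b (-x) k =
      -trajectory (fun x b => gaussNewtonStep b (fun j => observation z (b j)) x) b x k := by
  induction k with
  | zero => rfl
  | succ k ih => rw [trajectory, trajectory, ih, gaussNewtonStep_neg]

theorem signDist_neg {n : ℕ} (x z : RVec n) : signDist (-x) z = signDist x z := by
  rw [signDist, signDist, sub_neg_eq_add, ← sub_eq_add_neg, min_comm]

theorem signDist_le {n : ℕ} (x z : RVec n) : signDist x z ≤ ‖x - z‖ :=
  (min_le_left _ _).trans (norm_sub_rev z x).le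

/-- Quadratic convergence of a sequence of steps, each of which squares the scaled error. -/
theorem scaled_error_le {n m T : ℕ} {z : RVec n} (hz : ‖z‖ = 1)
    {b : Fin (T + 1) → Fin m → CVec n} {x : RVec n} (hx : 315 * ‖x - z‖ ≤ 1 / 4)
    (hstep : ∀ k : Fin T, 1 / 2 ≤ ‖trajectory (fun x b =>
        gaussNewtonStep b (fun j => observation z (b j)) x) b x k‖ →
      StepRegular z (trajectory (fun x b =>
        gaussNewtonStep b (fun j => observation z (b j)) x) b x k) (b k.succ)) (k : ℕ) (hk : k ≤ T) :
    315 * ‖trajectory (fun x b => gaussNewtonStep b (fun j => observation z (b j)) x) b x k - z‖ ≤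
      (1 / 4) ^ 2 ^ k ∧
    1 / 2 ≤ ‖trajectory (fun x b => gaussNewtonStep b (fun j => observation z (b j)) x) b x k‖ := by
  set t := trajectory (fun x b => gaussNewtonStep b (fun j => observation z (b j)) x) b x
  -- Closeness to `z` keeps the iterates away from `0`, where the Jacobian degenerates.
  have hhalf : ∀ k, 315 * ‖t k - z‖ ≤ (1 / 4) ^ 2 ^ k → 1 / 2 ≤ ‖t k‖ := fun k h => by
    have h1 : ((1 : ℝ) / 4) ^ 2 ^ k ≤ 1 := pow_le_one₀ (by norm_num) (by norm_num)
    have h2 := norm_sub_norm_le z (t k)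
    rw [norm_sub_rev, hz] at h2
    linarith
  suffices h : 315 * ‖t k - z‖ ≤ (1 / 4) ^ 2 ^ k from ⟨h, hhalf k h⟩
  induction k with
  | zero =>
    rw [pow_zero, pow_one]
    exact hx
  | succ k ih =>
    have ih := ih (by omega)
    have h := (hstep ⟨k, hk⟩ (hhalf k ih)).2
    rw [← trajectory_succ (fun x b => gaussNewtonStep b (fun j => observation z (b j)) x)] at h
    calc 315 * ‖t (k + 1) - z‖ ≤ 315 * (315 * ‖t k - z‖ ^ 2) := by gcongr
      _ = (315 * ‖t k - z‖) ^ 2 := by ring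
      _ ≤ ((1 / 4) ^ 2 ^ k) ^ 2 := by gcongr
      _ = (1 / 4) ^ 2 ^ (k + 1) := by rw [← pow_mul, pow_succ 2 k]

/-- The success of the method on given blocks. -/
def MethodSucceeds {n m T : ℕ} (z : RVec n) (b : Fin (T + 1) → Fin m → CVec n) : Prop :=
  (∃ x, IsInitialGuess (b 0) (fun j => observation z (b 0 j)) x) ∧
    ∀ x, IsInitialGuess (b 0) (fun j => observation z (b 0 j)) x →
      (∀ k : Fin T, IsUnit (gram (b k.succ) (trajectory (fun x b =>
        gaussNewtonStep b (fun j => observation z (b j)) x) b x k))) ∧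
      315 * signDist (trajectory (fun x b =>
        gaussNewtonStep b (fun j => observation z (b j)) x) b x T) z ≤ (1 / 4) ^ 2 ^ T

theorem exists_sample_size_methodSucceeds (T : ℕ) :
    ∃ C > 0, ∀ n m : ℕ, 2 ≤ n → C * (n * Real.log n) ≤ m → ∀ z : RVec n, ‖z‖ = 1 →
      ∃ S : Set (Fin (T + 1) → Fin m → CVec n), MeasurableSet S ∧
        (Measure.pi fun _ : Fin (T + 1) => Measure.pi fun _ : Fin m => complexGaussian n).real Sᶜ ≤
          1 / (n : ℝ) ^ 2 ∧
        ∀ b ∈ S, MethodSucceeds z b := by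
  have hT : (0 : ℝ) < T + 1 := by positivity
  -- Here `128 η = 1 / 1260²` and `1260 = 4 · 315`, so the scaled initial error is at most `1/4`.
  -- The shares `1 / (T + 1)` of the initialization and the `T` steps add up to `1`.
  obtain ⟨C₁, hC₁, H₁⟩ := exists_initRegular (η := 1 / 203212800) (τ := 1 / (T + 1))
    (by norm_num) (by norm_num) (by positivity)
  obtain ⟨C₂, hC₂, H₂⟩ := exists_sample_size_stepRegular (τ := 1 / ((T : ℝ) + 1)) (by positivity)
  refine ⟨max C₁ C₂, lt_max_of_lt_left hC₁, fun n m hn hm z hz => ?_⟩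
  have hn' : (1 : ℝ) < n := by exact_mod_cast (by omega : 1 < n)
  have hlog : 0 < (n : ℝ) * Real.log n := by
    have := Real.log_pos hn'
    positivity
  have hm₁ : C₁ * (n * Real.log n) ≤ m := le_trans (by gcongr; exact le_max_left _ _) hm
  have hm₂ : C₂ * (n * Real.log n) ≤ m := le_trans (by gcongr; exact le_max_right _ _) hm
  have hm0 : (0 : ℝ) < m := lt_of_lt_of_le (by positivity) hm₁
  have hm0' : 0 < m := by exact_mod_cast hm0
  obtain ⟨S₀, hS₀, hp₀, hreg⟩ := H₁ n m hn hm₁ z hz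
  obtain ⟨f, hf, hfx⟩ := exists_measurable_guess (by norm_num) hm0' z hS₀ hreg
  -- Nothing is required from points of norm below `1/2`, so the failure bound holds from every
  -- point, as the trajectory argument demands.
  let G : Set (RVec n × (Fin m → CVec n)) := {p | 1 / 2 ≤ ‖p.1‖ → StepRegular z p.1 p.2}
  have hG : MeasurableSet G := by
    have : G = {p | 1 / 2 ≤ ‖p.1‖}ᶜ ∪ {p | StepRegular z p.1 p.2} := by
      ext p; exact imp_iff_not_or
    rw [this]
    exact (measurableSet_le measurable_const measurable_fst.norm).compl.union
      (measurableSet_stepRegular z)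
  have hpG : ∀ x, (Measure.pi fun _ : Fin m => complexGaussian n).real {b | (x, b) ∉ G} ≤
      1 / ((T : ℝ) + 1) / (n : ℝ) ^ 2 := fun x => by
    by_cases hx : 1 / 2 ≤ ‖x‖
    · refine (measureReal_mono fun b hb => ?_).trans (H₂ n m hn hm₂ z x hx)
      exact fun hs => hb fun _ => hs
    · have : {b | (x, b) ∉ G} = (∅ : Set (Fin m → CVec n)) :=
        Set.eq_empty_of_forall_notMem fun b hb => hb fun h => absurd h hx
      rw [this, measureReal_empty]
      positivity
  obtain ⟨S₁, hS₁, hp₁, hgood⟩ := exists_trajectory_good (T := T)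
    (Measure.pi fun _ : Fin m => complexGaussian n)
    (step := fun x b => gaussNewtonStep b (fun j => observation z (b j)) x)
    (measurable_gaussNewtonStep z) hf hG hpG
  have hev := measurePreserving_eval
    (fun _ : Fin (T + 1) => Measure.pi fun _ : Fin m => complexGaussian n) 0
  refine ⟨Function.eval 0 ⁻¹' S₀ ∩ S₁, (hev.measurable hS₀).inter hS₁, ?_, ?_⟩
  · rw [Set.compl_inter, ← Set.preimage_compl]
    refine (measureReal_union_le _ _).trans ?_
    rw [hev.measureReal_preimage hS₀.compl.nullMeasurableSet]
    refine (add_le_add hp₀ hp₁).trans_eq ?_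
    field_simp
    ring
  · rintro b ⟨hb₀, hb₁⟩
    have hr := hreg (b 0) hb₀
    have hg := hgood b hb₁
    have main : ∀ x, IsInitialGuess (b 0) (fun j => observation z (b 0 j)) x →
        0 ≤ (inner ℝ x z : ℝ) →
        (∀ k : Fin T, IsUnit (gram (b k.succ) (trajectory (fun x b =>
          gaussNewtonStep b (fun j => observation z (b j)) x) b x k))) ∧
        315 * signDist (trajectory (fun x b =>
          gaussNewtonStep b (fun j => observation z (b j)) x) b x T) z ≤ (1 / 4) ^ 2 ^ T := by
      intro x hx hxz
      have hfb : f (b 0) = x :=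
        hfx (b 0) hb₀ x (hr.isNormalizedGuess hm0' (by norm_num) hz hx hxz)
      rw [hfb] at hg
      have hd := hr.norm_sub_sq_le hm0' (by norm_num) hz hx hxz
      have hd' : 315 * ‖x - z‖ ≤ 1 / 4 := by
        refine le_of_sq_le_sq ?_ (by norm_num)
        rw [mul_pow]
        linarith
      have hconv := scaled_error_le hz hd' hg
      refine ⟨fun k => (hg k (hconv k k.2.le).2).1, le_trans ?_ (hconv T le_rfl).1⟩
      gcongr
      exact signDist_le _ _
    refine ⟨hr.exists_isInitialGuess hm0' (by norm_num) hz, fun x hx => ?_⟩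
    rcases le_total 0 (inner ℝ x z : ℝ) with hxz | hxz
    · exact main x hx hxz
    · have h := main (-x) hx.neg (by rw [inner_neg_left]; linarith)
      simp only [gaussNewtonStep_trajectory_neg, gram_neg, signDist_neg] at h
      exact h

/-! ### Transfer from the probability space to the blocks -/

/-- The blocks of a family of Gaussian measurements are independent families of independent
Gaussian measurements. -/
theorem hasLaw_block {Ω : Type*} [MeasurableSpace Ω] {μ : Measure Ω} {m n T : ℕ}
    {a : Fin m → Ω → CVec n} (ha : IsGaussianMeasurements μ a) (σ : Blocks m T) :
    HasLaw (fun ω k => block σ (fun j => a j ω) k)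
      (Measure.pi fun _ : Fin (T + 1) => Measure.pi fun _ : Fin (m / (T + 1)) =>
        complexGaussian n) μ := by
  have h1 : HasLaw (fun ω (p : Fin (T + 1) × Fin (m / (T + 1))) => a (σ p) ω)
      (Measure.pi fun _ => complexGaussian n) μ :=
    (ha.1.precomp σ.injective).hasLaw_pi fun p => ha.2 (σ p)
  have h2 := Measure.infinitePi_map_curry (ι := Fin (T + 1)) (κ := Fin (m / (T + 1)))
    (fun _ _ => complexGaussian n)
  simp only [Measure.infinitePi_eq_pi] at h2
  have hc := (MeasurableEquiv.curry (Fin (T + 1)) (Fin (m / (T + 1))) (CVec n)).measurable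
  refine ⟨hc.comp_aemeasurable h1.aemeasurable, ?_⟩
  rw [← h2, ← h1.map_eq, AEMeasurable.map_map_of_aemeasurable hc.aemeasurable h1.aemeasurable]
  rfl

/-- Random variables are only almost everywhere measurable, so the preimage is only null-measurable;
a measurable subset of the same measure replaces it. -/
theorem exists_measurable_subset_preimage {Ω α : Type*} [MeasurableSpace Ω] [MeasurableSpace α]
    {μ : Measure Ω} {ν : Measure α} {X : Ω → α} (hX : HasLaw X ν μ) {S : Set α}
    (hS : MeasurableSet S) : ∃ E ⊆ X ⁻¹' S, MeasurableSet E ∧ μ.real E = ν.real S := by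
  obtain ⟨E, hE, hEm, hae⟩ :=
    (hX.aemeasurable.nullMeasurableSet_preimage hS).exists_measurable_subset_ae_eq
  refine ⟨E, hE, hEm, ?_⟩
  rw [measureReal_congr hae, measureReal_def, measureReal_def, ← hX.map_eq,
    Measure.map_apply_of_aemeasurable hX.aemeasurable hS]

/-! ### The iteration count -/

theorem loglog_pos {ε : ℝ} (hε : 0 < ε) (hε' : ε < 1 / 2) : 0 < loglog ε := by
  have h1 : 2 < 1 / ε := by rw [lt_div_iff₀ hε]; linarith
  have h2 : 1 < Real.logb 2 (1 / ε) := by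
    rw [Real.lt_logb_iff_rpow_lt one_lt_two (by positivity), Real.rpow_one]; exact h1
  exact Real.logb_pos one_lt_two h2

/-- The choice of `T` gives `2 ^ T ≥ log₂ (1/ε)`, so already `(1/2) ^ 2 ^ T ≤ ε`; the base `1/4`
makes the inequality strict. -/
theorem quarter_pow_two_pow_lt {c ε : ℝ} (hc : 1 ≤ c) (hε : 0 < ε) (hε' : ε < 1 / 2) :
    ((1 : ℝ) / 4) ^ 2 ^ iterationCount c ε < ε := by
  set T := iterationCount c ε
  have hL := loglog_pos hε hε'
  have hT : loglog ε ≤ T := le_trans (by nlinarith) (Nat.le_ceil (c * loglog ε))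
  have h1 : 1 < Real.logb 2 (1 / ε) := by
    have h1 : 2 < 1 / ε := by rw [lt_div_iff₀ hε]; linarith
    rw [Real.lt_logb_iff_rpow_lt one_lt_two (by positivity), Real.rpow_one]; exact h1
  have h2 : Real.logb 2 (1 / ε) ≤ (2 ^ T : ℕ) := by
    rw [loglog, Real.logb_le_iff_le_rpow one_lt_two (by linarith), Real.rpow_natCast] at hT
    exact_mod_cast hT
  rw [Real.logb_le_iff_le_rpow one_lt_two (by positivity), Real.rpow_natCast] at h2
  have h3 : ((1 : ℝ) / 2) ^ 2 ^ T ≤ ε := by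
    rw [one_div_pow, one_div_le (by positivity) hε]
    exact h2
  refine lt_of_lt_of_le ?_ h3
  exact pow_lt_pow_left₀ (by norm_num) (by norm_num) (by positivity)

theorem IsRun.eq_trajectory {m n T : ℕ} {σ : Blocks m T} {a : Fin m → CVec n} {z : RVec n}
    {x : Fin (T + 1) → RVec n} (h : IsRun σ a (fun j => observation z (a j)) x) (k : Fin (T + 1)) :
    x k = trajectory (fun x b => gaussNewtonStep b (fun j => observation z (b j)) x)
      (fun k => block σ a k) (x 0) k := by
  induction k using Fin.induction with
  | zero => rfl
  | succ k ih =>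
    rw [h.2 k, ih, Fin.val_succ, trajectory_succ]
    rfl

end GaussNewtonPR

/-! ### Assembly of the theorem -/

theorem mainTheorem3 :
    ∃ c₀ > (0 : ℝ), ∃ c' > (0 : ℝ), ∀ c ≥ c₀, ∀ ε : ℝ, 0 < ε → ε < 1 / 2 →
      ∃ C > (0 : ℝ), ∀ (n m : ℕ) (z : GaussNewtonPR.RVec n), ‖z‖ = 1 →
        C * GaussNewtonPR.loglog ε * (n * Real.log n) ≤ (m : ℝ) →
        ∀ (Ω : Type*) [MeasurableSpace Ω] (μ : Measure Ω) [IsProbabilityMeasure μ]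
          (a : Fin m → Ω → GaussNewtonPR.CVec n),
          GaussNewtonPR.IsGaussianMeasurements μ a →
          ∀ σ : GaussNewtonPR.Blocks m (GaussNewtonPR.iterationCount c ε),
            ∃ E : Set Ω, MeasurableSet E ∧ 1 - c' / (n : ℝ) ^ 2 ≤ μ.real E ∧
              ∀ ω ∈ E,
                (∃ x, GaussNewtonPR.IsRun σ (fun j => a j ω)
                  (fun j => GaussNewtonPR.observation z (a j ω)) x) ∧
                ∀ x, GaussNewtonPR.IsRun σ (fun j => a j ω)
                    (fun j => GaussNewtonPR.observation z (a j ω)) x →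
                  (∀ k, IsUnit (GaussNewtonPR.stepGram σ (fun j => a j ω) x k)) ∧
                  GaussNewtonPR.signDist (x (Fin.last _)) z < ε := by
  open GaussNewtonPR in
  refine ⟨1, one_pos, 1, one_pos, fun c hc ε hε hε' => ?_⟩
  have hL := loglog_pos hε hε'
  set T := iterationCount c ε with hTdef
  obtain ⟨C, hC, H⟩ := exists_sample_size_methodSucceeds T
  -- Division by `loglog ε` cancels the factor in the hypothesis, `T + 1` counts the blocks, and the
  -- extra `1` pays for the floor in the block size, since `n log n ≥ 1` when `n ≥ 2`.
  refine ⟨(T + 1) * (C + 1) / loglog ε, by positivity, ?_⟩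
  intro n m z hz hm Ω _ μ _ a ha σ
  -- A unit vector excludes `n = 0`, and for `n = 1` the required probability is `0`.
  rcases Nat.lt_or_ge n 2 with hn | hn
  · have hn1 : n = 1 := by
      have : n ≠ 0 := by
        rintro rfl
        rw [Subsingleton.elim z 0, norm_zero] at hz
        exact zero_ne_one hz
      omega
    refine ⟨∅, MeasurableSet.empty, ?_, fun ω hω => absurd hω (Set.notMem_empty ω)⟩
    simp [hn1]
  have hn' : (2 : ℝ) ≤ n := by exact_mod_cast hn
  have hnlog : 1 ≤ n * Real.log n := by
    have h1 : Real.log 2 ≤ Real.log n := Real.log_le_log two_pos hn'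
    have h2 := Real.log_two_gt_d9
    nlinarith
  have hm' : C * (n * Real.log n) ≤ (m / (T + 1) : ℕ) := by
    have hT : (0 : ℝ) < T + 1 := by positivity
    rw [div_mul_cancel₀ _ hL.ne'] at hm
    have h1 : (m : ℝ) < (T + 1) * ((m / (T + 1) : ℕ) + 1) := by
      exact_mod_cast Nat.lt_mul_div_succ m (Nat.succ_pos T)
    have h2 : (T + 1) * ((C + 1) * (n * Real.log n)) <
        ((T : ℝ) + 1) * ((m / (T + 1) : ℕ) + 1) := by
      refine lt_of_le_of_lt ?_ h1
      rwa [← mul_assoc]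
    have h3 := lt_of_mul_lt_mul_left h2 hT.le
    linarith
  obtain ⟨S, hS, hp, hgood⟩ := H n (m / (T + 1)) hn hm' z hz
  obtain ⟨E, hES, hE, hEp⟩ := exists_measurable_subset_preimage (hasLaw_block ha σ) hS
  refine ⟨E, hE, ?_, fun ω hω => ?_⟩
  · rw [hEp]
    rw [probReal_compl_eq_one_sub hS] at hp
    linarith
  obtain ⟨⟨x₀, hx₀⟩, hall⟩ := hgood _ (hES hω)
  set t := trajectory (fun x b => gaussNewtonStep b (fun j => observation z (b j)) x)
    (fun k => block σ (fun j => a j ω) k)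
  refine ⟨⟨fun k => t x₀ k, hx₀, fun k => ?_⟩, fun x hx => ?_⟩
  · exact trajectory_succ _ _ _ k
  · obtain ⟨h1, h2⟩ := hall (x 0) hx.1
    refine ⟨fun k => ?_, ?_⟩
    · rw [stepGram, hx.eq_trajectory k.castSucc]
      exact h1 k
    · rw [hx.eq_trajectory (Fin.last _)]
      have h3 := quarter_pow_two_pow_lt hc hε hε'
      have h4 : 0 ≤ signDist (t (x 0) T) z := le_min (norm_nonneg _) (norm_nonneg _)
      change signDist (t (x 0) T) z < ε
      change 315 * signDist (t (x 0) T) z ≤ _ at h2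
      rw [← hTdef] at h3
      linarith
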